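/- **Conventions.** For a smooth map $f$ defined near a point $x$ of a real vector space, let $\mathrm{ord}_x(f)\in\mathbb N\cup\{\infty\}$ be the least order of a partial derivative of $f$ not vanishing at $x$ ($\infty$ if there is none). For a real function $k$, smooth near $z_0\in\mathbb C^N$, let $$\mathrm{typ}_{z_0}(k)=\sup_{\varphi}\frac{\mathrm{ord}_0\left(k\circ\varphi-k(z_0)\right)}{\mathrm{ord}_0(\varphi-z_0)}\in[0,\infty],$$ the supremum being over all non-constant holomorphic maps $\varphi$ from the unit disc to $\mathbb C^N$ with $\varphi(0)=z_0$; $k$ is of finite type at $z_0$ if $\mathrm{typ}_{z_0}(k)<\infty$. If $D$ is a domain with smooth boundary and $x\in\partial D$, then $\mathrm{typ}_x(\partial D)$ is the type at $x$ of any smooth local defining function of $D$ near $x$; $D$ is of finite type if $\mathrm{typ}_x(\partial D)<\infty$ for all $x\in\partial D$. Such a $D$ is pseudo-convex if at each boundary point the Levi form of a local defining function is non-negative on the complex tangent space. **Setting.** Let $n\ge1$ and $p,m_1,\dots,m_p\ge0$ be integers and let $\Omega\subset\mathbb C^n$ be a bounded domain with smooth boundary. Let $\rho$ be a smooth real function on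 an open neighbourhood $U$ of $\overline\Omega$ with $\Omega=\{z\in U:\rho(z)<0\}$ and $\nabla\rho\ne0$ on $\partial\Omega$. Assume that $\rho$ is plurisubharmonic on $U$ and of finite type at every point of $\overline\Omega$. For $1\le i\le p$ let $h_i$ be a non-negative smooth plurisubharmonic function on $\mathbb C^{m_i}$ such that (Condition II) - $h_i(w_i)=0\Leftrightarrow w_i=0$; $\nabla h_i(w_i)\neq0$ if $w_i\ne0$; and $h_i(w_i)\to+\infty$ as $|w_i|\to\infty$; - $\log h_i$ is plurisubharmonic, and $h_i$ is strictly plurisubharmonic outside the origin; - $h_i$ is of finite type at the origin. Let $\widetilde\Omega=\{(z,w)\in\Omega\times\mathbb C^{m_1}\times\dots\times\mathbb C^{m_p}:\ \rho(z)+\sum_{i=1}^p h_i(w_i)<0\}$. **Conclusion.** $\widetilde\Omega$ is a bounded domain with smooth boundary, and it is pseudo-convex and of finite type. More precisely, for every $(z,w)\in\partial\widetilde\Omega$, $$\mathrm{typ}_{(z,w)}(\partial\widetilde\Omega)\le\max\Big\{\mathrm{typ}_{z}(\partial\Omega),\ \max_{1\le i\le p}\mathrm{typ}_0(h_i)\Big\}\quad\text{if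 } w=0,$$ $$\mathrm{typ}_{(z,w)}(\partial\widetilde\Omega)\le\max\Big\{2\,\mathrm{typ}_{z}(\rho),\ \max_{i\,:\,w_i=0}\mathrm{typ}_0(h_i)\Big\}\quad\text{if } w\neq0$$ (a maximum over an empty set of indices is $0$). -/

import Mathlib

open scoped ContDiff

noncomputable section

namespace Hartogs

variable {E : Type*} [NormedAddCommGroup E] [NormedSpace ℂ E]

/-- The order of vanishing `ord_x (f)` of a smooth map `f` at `x`: the least `k` such that some
partial derivative of order `k` of `f` is non-zero at `x`, and `∞` if there is none. -/
def order {D G : Type*} [NormedAddCommGroup D] [NormedSpace ℝ D]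
    [NormedAddCommGroup G] [NormedSpace ℝ G] (f : D → G) (x : D) : ℕ∞ :=
  ⨅ (k : ℕ) (_ : iteratedFDeriv ℝ k f x ≠ 0), (k : ℕ∞)

/-- `φ` is (on the unit disc) a non-constant holomorphic disc centred at `z₀`. -/
structure IsDiscAt (φ : ℂ → E) (z₀ : E) : Prop where
  holomorphic : DifferentiableOn ℂ φ (Metric.ball 0 1)
  center : φ 0 = z₀
  nonconstant : ∃ ζ ∈ Metric.ball (0 : ℂ) 1, φ ζ ≠ z₀

/-- The type `typ_{z₀} (k)` of a function `k`, smooth near `z₀`: the supremum of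
`ord₀ (k ∘ φ - k z₀) / ord₀ (φ - z₀)` over the non-constant holomorphic discs `φ`
centred at `z₀`. -/
def typ (k : E → ℝ) (z₀ : E) : ENNReal :=
  ⨆ (φ : ℂ → E) (_ : IsDiscAt φ z₀),
    ((order (fun ζ => k (φ ζ) - k z₀) 0 : ℕ∞) : ENNReal) /
      ((order (fun ζ => φ ζ - z₀) 0 : ℕ∞) : ENNReal)

/-- The Levi form `∑ ∂²f/∂z_j∂z̄_k (z) t_j t̄_k`, written through the real second derivative. -/
def leviForm (f : E → ℝ) (z t : E) : ℝ :=
  (fderiv ℝ (fderiv ℝ f) z t t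
    + fderiv ℝ (fderiv ℝ f) z (Complex.I • t) (Complex.I • t)) / 4

/-- Plurisubharmonicity on the open set `U` of a function that is smooth on `U`. -/
def IsPshOn (f : E → ℝ) (U : Set E) : Prop :=
  ∀ z ∈ U, ∀ t : E, 0 ≤ leviForm f z t

/-- Strict plurisubharmonicity on the open set `U` of a function that is smooth on `U`. -/
def IsStrictlyPshOn (f : E → ℝ) (U : Set E) : Prop :=
  ∀ z ∈ U, ∀ t : E, t ≠ 0 → 0 < leviForm f z t

/-- `r` is a smooth local defining function of `Ω` near the boundary point `x`. -/
def IsLocalDefiningFunction (Ω : Set E) (x : E) (r : E → ℝ) : Prop :=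
  r x = 0 ∧ fderiv ℝ r x ≠ 0 ∧
    ∃ U : Set E, IsOpen U ∧ x ∈ U ∧ ContDiffOn ℝ ∞ r U ∧ ∀ z ∈ U, z ∈ Ω ↔ r z < 0

/-- A bounded domain with smooth boundary. -/
structure IsSmoothBoundedDomain (Ω : Set E) : Prop where
  isOpen : IsOpen Ω
  isConnected : IsConnected Ω
  isBounded : Bornology.IsBounded Ω
  smooth_boundary : ∀ x ∈ frontier Ω, ∃ r, IsLocalDefiningFunction Ω x r

/-- Pseudo-convexity of a domain with smooth boundary: at every boundary point, the Levi form of a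
local defining function `r` (the choice of `r` does not matter) is non-negative on the complex
tangent space of the boundary. -/
def IsPseudoconvex (Ω : Set E) : Prop :=
  ∀ x ∈ frontier Ω, ∃ r, IsLocalDefiningFunction Ω x r ∧
    ∀ t : E, fderiv ℝ r x t = 0 → fderiv ℝ r x (Complex.I • t) = 0 → 0 ≤ leviForm r x t

/-- The type at `x` of the boundary of a domain with smooth boundary: the type at `x` of a local
defining function. All local defining functions at `x` have the same type, so that the infimum
only serves to pick this common value. -/
def bdryTyp (Ω : Set E) (x : E) : ENNReal :=
  ⨅ (r : E → ℝ) (_ : IsLocalDefiningFunction Ω x r), typ r x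

/-- The boundary of `Ω` is of finite type at each of its points. -/
def IsOfFiniteType (Ω : Set E) : Prop :=
  ∀ x ∈ frontier Ω, bdryTyp Ω x < ⊤

/-- `ρ` is a (global) smooth defining function of `Ω`, defined on the open
neighbourhood `U` of the closure of `Ω`. -/
structure IsDefiningFunctionOn (Ω : Set E) (ρ : E → ℝ) (U : Set E) : Prop where
  isOpen : IsOpen U
  closure_subset : closure Ω ⊆ U
  smooth : ContDiffOn ℝ ∞ ρ U
  mem_iff : ∀ z ∈ U, z ∈ Ω ↔ ρ z < 0
  gradient_ne_zero : ∀ z ∈ frontier Ω, fderiv ℝ ρ z ≠ 0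

/-- Condition II for one of the functions `h_i`. In `log_psh` the origin is left out because
`log h_i` is `-∞` there, where plurisubharmonicity requires nothing. -/
structure ConditionIIAt (h : E → ℝ) : Prop where
  smooth : ContDiff ℝ ∞ h
  nonneg : ∀ w, 0 ≤ h w
  psh : IsPshOn h Set.univ
  eq_zero_iff : ∀ w, h w = 0 ↔ w = 0
  gradient_ne_zero : ∀ w, w ≠ 0 → fderiv ℝ h w ≠ 0
  tendsto_atTop : Filter.Tendsto h (Bornology.cobounded E) Filter.atTop
  log_psh : IsPshOn (fun w => Real.log (h w)) {w | w ≠ 0}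
  strictly_psh : IsStrictlyPshOn h {w | w ≠ 0}
  finite_type : typ h 0 < ⊤

/-- Condition II for `h (w) = ∑ i, h_i (w_i)`. -/
def ConditionII {ι : Type*} {F : ι → Type*} [∀ i, NormedAddCommGroup (F i)]
    [∀ i, NormedSpace ℂ (F i)] (h : ∀ i, F i → ℝ) : Prop :=
  ∀ i, ConditionIIAt (h i)

/-- The set of the `(z, w)` with `ρ (z) + ∑ i, h_i (w_i) < 0`. As `ρ` need only be defined near the
closure of `Ω`, and as `h` is non-negative, `z` is taken in `Ω`. -/
def hartogsDomain {ι : Type*} [Fintype ι] {F : ι → Type*} (Ω : Set E) (ρ : E → ℝ)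
    (h : ∀ i, F i → ℝ) : Set (E × (∀ i, F i)) :=
  {x | x.1 ∈ Ω ∧ ρ x.1 + ∑ i, h i (x.2 i) < 0}

end Hartogs

end

namespace Hartogs

open Filter Topology Asymptotics

set_option linter.unusedSectionVars false

/-! ### Symmetry of higher derivatives -/

section Symmetry

variable {D : Type} {G : Type*} [NormedAddCommGroup D] [NormedSpace ℝ D]
  [NormedAddCommGroup G] [NormedSpace ℝ G]

/-! The function `r = ρ(z) + ∑ h_i(w_i)` is a plurisubharmonic defining function of the domain. Its
gradient comes from `ρ` when `w = 0` and from some `h_i` otherwise. Connectedness holds because each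
fibre over `z` is a sublevel set of `∑ h_i`, whose only critical point is the origin. The substance
is the bound on the type.

Along a disc `φ` centred at `x = (z, w)`, write `r ∘ φ - r x = G + S`, where `S` collects the `h_i`
with `w_i = 0` and `G` (`nonvanishingPart`) the rest. `G` is subharmonic, `S ≥ 0` and `S 0 = 0`.
Their leading parts cannot cancel (`le_order_of_le_order_add`): otherwise the leading part of `S`
would be non-negative, superharmonic and homogeneous of positive degree, hence zero. So the order of
`G + S` is at most that of `G` and that of each summand of `S`.

The order of `φ - x` is attained by one component. For a `w_i` component with `w_i = 0`, the summand
of `S` gives `typ (h_i)`. For one with `w_i ≠ 0`, strict plurisubharmonicity bounds `|φ_i'|²` by the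
Levi form of `G`, so `G` has order at most twice that of the component, and `2 ≤ 2 typ ρ`. For the
`z` component with `w ≠ 0`, plurisubharmonicity of `log h_i` bounds the squared gradient of `u = h_i
∘ φ_i` by its Laplacian; hence `G` has order at most twice that of `u - u 0`, and then at most twice
that of its `ρ` term. If `w = 0`, `G` is the `ρ` term itself and the factor 2 disappears. -/

theorem contDiffAt_fderiv {f : D → G} {x : D} (hf : ContDiffAt ℝ ∞ f x) :
    ContDiffAt ℝ ∞ (fderiv ℝ f) x :=
  hf.fderiv_right (by simp)

theorem eventually_contDiffAt {f : D → G} {x : D} (hf : ContDiffAt ℝ ∞ f x) (n : ℕ) :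
    ∀ᶠ y in 𝓝 x, ContDiffAt ℝ n f y :=
  (hf.of_le (by exact_mod_cast le_top)).eventually (by simp)

theorem eventually_fderiv_fderiv_comm {f : D → G} {x : D} (hf : ContDiffAt ℝ ∞ f x) :
    ∀ᶠ y in 𝓝 x, ∀ v w, fderiv ℝ (fderiv ℝ f) y v w = fderiv ℝ (fderiv ℝ f) y w v := by
  filter_upwards [eventually_contDiffAt hf 2] with y hy v w
  exact (hy.isSymmSndFDerivAt (by simp)) v w

theorem iteratedFDeriv_apply_apply (n : ℕ) {H : D → D →L[ℝ] D →L[ℝ] G} {x : D}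
    (hH : ContDiffAt ℝ ∞ H x) (u : Fin n → D) (v w : D) :
    iteratedFDeriv ℝ n (fun y => H y v w) x u = iteratedFDeriv ℝ n H x u v w := by
  have hn : (n : ℕ∞ω) ≤ ∞ := by exact_mod_cast le_top
  have h1 := (ContinuousLinearMap.apply ℝ (D →L[ℝ] G) v).iteratedFDeriv_comp_left hH hn
  have h2 := (ContinuousLinearMap.apply ℝ G w).iteratedFDeriv_comp_left
    (hH.clm_apply (contDiffAt_const (c := v))) hn
  refine (DFunLike.congr_fun h2 u).trans ?_
  exact congrArg (fun T : D →L[ℝ] G => T w) (DFunLike.congr_fun h1 u)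

theorem iteratedFDeriv_apply_comm (n : ℕ) {H : D → D →L[ℝ] D →L[ℝ] G} {x : D}
    (hH : ContDiffAt ℝ ∞ H x) (hc : ∀ᶠ y in 𝓝 x, ∀ v w, H y v w = H y w v)
    (u : Fin n → D) (v w : D) :
    iteratedFDeriv ℝ n H x u v w = iteratedFDeriv ℝ n H x u w v := by
  rw [← iteratedFDeriv_apply_apply n hH, ← iteratedFDeriv_apply_apply n hH]
  have : (fun y => H y v w) =ᶠ[𝓝 x] fun y => H y w v := hc.mono fun y hy => hy v w
  rw [(this.iteratedFDeriv ℝ n).eq_of_nhds]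

/-- The last argument belongs to the innermost derivative. A swap that avoids it is the induction
hypothesis for `fderiv ℝ f`, which is why the codomain varies; the last swap is the symmetry of the
second derivative, differentiated further. -/
theorem iteratedFDeriv_comp_swap (n : ℕ) : ∀ {G : Type _} [NormedAddCommGroup G] [NormedSpace ℝ G]
    {f : D → G} {x : D}, ContDiffAt ℝ ∞ f x → ∀ (i : Fin n) (v : Fin (n + 1) → D),
    iteratedFDeriv ℝ (n + 1) f x (v ∘ Equiv.swap i.castSucc i.succ)
      = iteratedFDeriv ℝ (n + 1) f x v := by
  induction n with
  | zero => intro G _ _ f x _ i; exact i.elim0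
  | succ n ih =>
    intro G _ _ f x hf i v
    induction i using Fin.lastCases with
    | last =>
      have key : ∀ v : Fin (n + 2) → D, iteratedFDeriv ℝ (n + 2) f x v
          = iteratedFDeriv ℝ n (fderiv ℝ (fderiv ℝ f)) x (Fin.init (Fin.init v))
            (v (Fin.last n).castSucc) (v (Fin.last (n + 1))) := by
        intro v
        rw [iteratedFDeriv_succ_apply_right, iteratedFDeriv_succ_apply_right]
        rfl
      have h0 : Fin.init (Fin.init (v ∘ Equiv.swap (Fin.last n).castSucc (Fin.last n).succ))
          = Fin.init (Fin.init v) := by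
        ext j
        simp only [Fin.init, Function.comp]
        rw [Equiv.swap_apply_of_ne_of_ne]
        · simp [Fin.ext_iff]; omega
        · simp [Fin.ext_iff]; omega
      rw [key, key, h0]
      simp only [Function.comp, Fin.succ_last, Equiv.swap_apply_left, Equiv.swap_apply_right]
      exact iteratedFDeriv_apply_comm n (contDiffAt_fderiv (contDiffAt_fderiv hf))
        (eventually_fderiv_fderiv_comm hf) _ _ _
    | cast i =>
      rw [iteratedFDeriv_succ_apply_right (n := n + 1),
        iteratedFDeriv_succ_apply_right (n := n + 1) (m := v),
        ← ih (contDiffAt_fderiv hf) i (Fin.init v)]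
      have h1 : (v ∘ Equiv.swap i.castSucc.castSucc i.castSucc.succ) (Fin.last (n + 1))
          = v (Fin.last (n + 1)) := by
        simp only [Function.comp]
        rw [Equiv.swap_apply_of_ne_of_ne]
        · simp [Fin.ext_iff]; omega
        · simp [Fin.ext_iff]; omega
      rw [h1]
      congr 1
      congr 1
      ext j
      simp only [Fin.init, Function.comp]
      congr 1
      have := Function.Embedding.swap_apply (Fin.castSuccEmb (n := n + 1)) i.castSucc i.succ j
      simpa using this

theorem iteratedFDeriv_comp_perm {n : ℕ} {f : D → G} {x : D} (hf : ContDiffAt ℝ ∞ f x)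
    (σ : Equiv.Perm (Fin n)) (v : Fin n → D) :
    iteratedFDeriv ℝ n f x (v ∘ σ) = iteratedFDeriv ℝ n f x v := by
  cases n with
  | zero => congr 1; ext i; exact i.elim0
  | succ n =>
    have hσ : σ ∈ Submonoid.closure
        (Set.range fun i : Fin n => Equiv.swap i.castSucc i.succ) := by
      rw [Equiv.Perm.mclosure_swap_castSucc_succ]; trivial
    induction hσ using Submonoid.closure_induction generalizing v with
    | mem s hs =>
      obtain ⟨i, rfl⟩ := hs
      exact iteratedFDeriv_comp_swap n hf i v
    | one => rfl
    | mul s t _ _ hs ht =>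
      rw [Equiv.Perm.coe_mul, ← Function.comp_assoc, ht, hs]

end Symmetry

/-! ### Order of vanishing, growth at the origin and leading homogeneous parts -/

section Order

variable {D : Type} {G : Type*} [NormedAddCommGroup D] [NormedSpace ℝ D]
  [NormedAddCommGroup G] [NormedSpace ℝ G]

theorem le_order_iff {f : D → G} {x : D} {n : ℕ} :
    (n : ℕ∞) ≤ order f x ↔ ∀ k < n, iteratedFDeriv ℝ k f x = 0 := by
  simp only [order, le_iInf_iff, Nat.cast_le]
  exact forall_congr' fun k => ⟨fun h hk => by_contra fun h' => absurd (h h') (by omega),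
    fun h h' => not_lt.1 fun hk => h' (h hk)⟩

theorem le_order_succ_iff {f : D → G} {x : D} {n : ℕ} :
    ((n + 1 : ℕ) : ℕ∞) ≤ order f x ↔ (n : ℕ∞) ≤ order f x ∧ iteratedFDeriv ℝ n f x = 0 := by
  simp only [le_order_iff]
  refine ⟨fun h => ⟨fun k hk => h k (by omega), h n (by omega)⟩, fun h k hk => ?_⟩
  rcases Nat.lt_succ_iff_lt_or_eq.1 hk with hk | rfl
  exacts [h.1 k hk, h.2]

theorem le_order_succ_iff_fderiv {f : D → G} {x : D} {n : ℕ} :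
    ((n + 1 : ℕ) : ℕ∞) ≤ order f x ↔ f x = 0 ∧ (n : ℕ∞) ≤ order (fderiv ℝ f) x := by
  simp only [le_order_iff]
  have h0 : iteratedFDeriv ℝ 0 f x = 0 ↔ f x = 0 := by
    rw [← norm_eq_zero, norm_iteratedFDeriv_zero, norm_eq_zero]
  have h1 : ∀ k, iteratedFDeriv ℝ (k + 1) f x = 0 ↔ iteratedFDeriv ℝ k (fderiv ℝ f) x = 0 := by
    intro k
    rw [← norm_eq_zero, ← norm_iteratedFDeriv_fderiv, norm_eq_zero]
  refine ⟨fun h => ⟨h0.1 (h 0 (by omega)), fun k hk => (h1 k).1 (h (k + 1) (by omega))⟩, ?_⟩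
  rintro ⟨h, h'⟩ (_ | k) hk
  · exact h0.2 h
  · exact (h1 k).2 (h' k (by omega))

theorem order_congr {f g : D → G} {x : D} (h : f =ᶠ[𝓝 x] g) : order f x = order g x := by
  unfold order
  simp only [(h.iteratedFDeriv ℝ _).eq_of_nhds]

theorem isBigO_of_le_order (n : ℕ) : ∀ {G : Type _} [NormedAddCommGroup G] [NormedSpace ℝ G]
    {f : D → G}, ContDiffAt ℝ ∞ f 0 → (n : ℕ∞) ≤ order f 0 →
    f =O[𝓝 0] fun x => ‖x‖ ^ n := by
  induction n with
  | zero =>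
    intro G _ _ f hf _
    simpa using hf.continuousAt.isBigO_one ℝ
  | succ n ih =>
    intro G _ _ f hf h
    obtain ⟨h0, h1⟩ := le_order_succ_iff_fderiv.1 h
    obtain ⟨C, hC⟩ := (ih (contDiffAt_fderiv hf) h1).bound
    obtain ⟨ε, hε, hball⟩ := Metric.eventually_nhds_iff_ball.1
      (hC.and (eventually_contDiffAt hf 1))
    refine IsBigO.of_bound C ?_
    filter_upwards [Metric.ball_mem_nhds (0 : D) hε] with x hx
    have hx' : ‖x‖ < ε := by simpa using hx
    have hsub : ∀ y ∈ Metric.closedBall (0 : D) ‖x‖, y ∈ Metric.ball (0 : D) ε := fun y hy => by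
      simp at hy ⊢; linarith
    have := (convex_closedBall (0 : D) ‖x‖).norm_image_sub_le_of_norm_fderiv_le (𝕜 := ℝ) (f := f)
      (C := C * ‖x‖ ^ n) (x := 0) (y := x)
      (fun y hy => (hball y (hsub y hy)).2.differentiableAt (by simp))
      (fun y hy => (hball y (hsub y hy)).1.trans ?_) (by simp) (by simp)
    · rw [h0, sub_zero, sub_zero] at this
      rw [norm_pow, norm_norm, pow_succ, ← mul_assoc]
      exact this
    -- The constant extracted from the `O` bound carries no sign; non-negativity is needed to
    -- replace `‖y‖` by `‖x‖`, and can fail only where `‖x‖ ^ n = 0`.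
    · have hC0 : 0 ≤ C ∨ ‖x‖ ^ n = 0 := by
        by_cases hz : ‖x‖ ^ n = 0
        · exact Or.inr hz
        · left
          have h3 := (norm_nonneg _).trans (hball x hx).1
          rw [norm_pow, norm_norm] at h3
          exact nonneg_of_mul_nonneg_left h3 (lt_of_le_of_ne (by positivity) (Ne.symm hz))
      have hy' : ‖y‖ ≤ ‖x‖ := by simpa using hy
      rw [norm_pow, norm_norm]
      rcases hC0 with hC0 | hz
      · gcongr
      · have : ‖x‖ = 0 := eq_zero_of_pow_eq_zero (n := n) hz
        rw [le_antisymm (hy'.trans this.le) (norm_nonneg y), this]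

/-- Differentiation lowers the degree of homogeneity by one, and a homogeneous map of positive
degree vanishes at the origin (take `t = 2`). -/
theorem le_order_of_homogeneous (n : ℕ) : ∀ {G : Type _} [NormedAddCommGroup G] [NormedSpace ℝ G]
    {Q : D → G}, (∀ (t : ℝ) x, 0 < t → Q (t • x) = t ^ n • Q x) → (n : ℕ∞) ≤ order Q 0 := by
  induction n with
  | zero => intros; simp
  | succ n ih =>
    intro G _ _ Q hQ
    rw [le_order_succ_iff_fderiv]
    constructor
    · have h := hQ 2 0 (by norm_num)
      rw [smul_zero] at h
      have h2 : ((2 : ℝ) ^ (n + 1) - 1) • Q 0 = 0 := by rw [sub_smul, ← h, one_smul, sub_self]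
      refine (smul_eq_zero.1 h2).resolve_left (sub_ne_zero.2 (ne_of_gt ?_))
      exact one_lt_pow₀ (by norm_num) (by simp)
    · refine ih fun t x ht => ?_
      have h := fderiv_comp_smul (f := Q) (x := x) (𝕜 := ℝ) t
      have h' : (fun x => Q (t • x)) = fun x => t ^ (n + 1) • Q x := funext fun x => hQ t x ht
      rw [h', show (fun x => t ^ (n + 1) • Q x) = t ^ (n + 1) • Q from rfl,
        fderiv_const_smul_field] at h
      rw [pow_succ', mul_smul] at h
      exact (smul_right_injective _ ht.ne' h).symm

theorem homogeneous_eq_zero {Q : D → G} {n : ℕ}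
    (hQ : ∀ (t : ℝ) x, 0 < t → Q (t • x) = t ^ n • Q x) (h : Q =o[𝓝 0] fun x => ‖x‖ ^ n) (x : D) :
    Q x = 0 := by
  have h1 : Tendsto (fun t : ℝ => t • x) (𝓝[>] 0) (𝓝 0) := by
    have : Tendsto (fun t : ℝ => t • x) (𝓝 0) (𝓝 ((0 : ℝ) • x)) :=
      (continuous_id.smul continuous_const).tendsto _
    rw [zero_smul] at this
    exact this.mono_left nhdsWithin_le_nhds
  by_contra hx
  obtain ⟨c, hc, hcx⟩ : ∃ c > 0, c * ‖x‖ ^ n < ‖Q x‖ := by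
    have : Tendsto (fun c : ℝ => c * ‖x‖ ^ n) (𝓝[>] 0) (𝓝 (0 * ‖x‖ ^ n)) :=
      ((continuous_id.mul continuous_const).tendsto _).mono_left nhdsWithin_le_nhds
    rw [zero_mul] at this
    have h0 : ∀ᶠ c in 𝓝[>] (0 : ℝ), 0 < c := self_mem_nhdsWithin
    exact (h0.and (this.eventually_lt_const (norm_pos_iff.2 hx))).exists
  obtain ⟨t, ht, ht0⟩ := ((h1.eventually (h.bound hc)).and self_mem_nhdsWithin).exists
  have ht0 : (0 : ℝ) < t := ht0
  rw [hQ t x ht0, norm_smul, norm_pow, norm_pow, norm_norm, norm_smul, mul_pow,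
    Real.norm_of_nonneg ht0.le, mul_left_comm] at ht
  exact absurd (le_of_mul_le_mul_left ht (by positivity)) (not_le.2 hcx)

theorem order_sub_le {f g : D → G} (hf : ContDiffAt ℝ ∞ f 0) (hg : ContDiffAt ℝ ∞ g 0) {n : ℕ}
    (h : (n : ℕ∞) ≤ order f 0) (h' : (n : ℕ∞) ≤ order g 0) : (n : ℕ∞) ≤ order (f - g) 0 := by
  rw [le_order_iff] at *
  intro k hk
  rw [iteratedFDeriv_sub_apply (hf.of_le (by exact_mod_cast le_top))
    (hg.of_le (by exact_mod_cast le_top)), h k hk, h' k hk, sub_zero]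

/-- The leading homogeneous part of a function of order at least `n`. -/
theorem exists_leading_part {f : D → G} (hf : ContDiffAt ℝ ∞ f 0) {n : ℕ}
    (h : (n : ℕ∞) ≤ order f 0) :
    ∃ Q : D → G, ContDiff ℝ ∞ Q ∧ (∀ (t : ℝ) x, 0 < t → Q (t • x) = t ^ n • Q x) ∧
      ((n + 1 : ℕ) : ℕ∞) ≤ order (f - Q) 0 := by
  set A := iteratedFDeriv ℝ n f 0 with hA
  -- Taylor's term: the `n`-th derivative of `B (x, …, x)` sums `B` over all permutations of its
  -- arguments, which by symmetry of `A` gives back `A`.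
  let B := (n.factorial : ℝ)⁻¹ • A
  have hQ : ContDiff ℝ ∞ fun x => B fun _ => x := B.contDiff.comp (contDiff_pi' fun _ => contDiff_id)
  have hhom : ∀ (t : ℝ) (x : D), 0 < t → (B fun _ => t • x) = t ^ n • B fun _ => x := by
    intro t x _
    have := B.map_smul_univ (fun _ => t) (fun _ => x)
    simpa using this
  refine ⟨fun x => B fun _ => x, hQ, hhom, le_order_succ_iff.2 ⟨?_, ?_⟩⟩
  · exact order_sub_le hf hQ.contDiffAt h (le_order_of_homogeneous n hhom)
  · rw [iteratedFDeriv_sub_apply (hf.of_le (by exact_mod_cast le_top))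
      (hQ.contDiffAt.of_le (by exact_mod_cast le_top)), sub_eq_zero]
    ext v
    rw [ContinuousMultilinearMap.iteratedFDeriv_comp_diagonal]
    have : ∀ σ : Equiv.Perm (Fin n), (B fun i => v (σ i)) = (n.factorial : ℝ)⁻¹ • A v := by
      intro σ
      simp only [B, smul_apply]
      congr 1
      exact iteratedFDeriv_comp_perm hf σ v
    simp only [this, Finset.sum_const, Finset.card_univ, Fintype.card_perm, Fintype.card_fin]
    rw [← Nat.cast_smul_eq_nsmul ℝ, smul_inv_smul₀ (by positivity)]

theorem isLittleO_norm_pow {D : Type*} [NormedAddCommGroup D] {m n : ℕ} (h : m < n) :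
    (fun x : D => ‖x‖ ^ n) =o[𝓝 0] fun x => ‖x‖ ^ m :=
  (isLittleO_pow_pow h).comp_tendsto (k := fun x : D => ‖x‖) (by simpa using tendsto_norm_zero)

theorem le_order_succ_of_isLittleO {f : D → G} (hf : ContDiffAt ℝ ∞ f 0) {n : ℕ}
    (h : (n : ℕ∞) ≤ order f 0) (h' : f =o[𝓝 0] fun x => ‖x‖ ^ n) :
    ((n + 1 : ℕ) : ℕ∞) ≤ order f 0 := by
  obtain ⟨Q, hQ, hhom, hord⟩ := exists_leading_part hf h
  have h1 : Q =o[𝓝 0] fun x => ‖x‖ ^ n := by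
    have := h'.sub ((isBigO_of_le_order _ (hf.sub hQ.contDiffAt) hord).trans_isLittleO
      (isLittleO_norm_pow n.lt_succ_self))
    simpa using this
  have : Q = 0 := funext (homogeneous_eq_zero hhom h1)
  rwa [this, sub_zero] at hord

/-- Conversely to the Taylor estimate, `f` is `o(‖x‖ ^ m)` for each `m < n`, so its homogeneous part
of degree `m` vanishes, and the order rises one step at a time. -/
theorem le_order_iff_isBigO {f : D → G} (hf : ContDiffAt ℝ ∞ f 0) {n : ℕ} :
    (n : ℕ∞) ≤ order f 0 ↔ f =O[𝓝 0] fun x => ‖x‖ ^ n := by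
  refine ⟨isBigO_of_le_order n hf, fun h => ?_⟩
  have : ∀ m ≤ n, (m : ℕ∞) ≤ order f 0 := by
    intro m hm
    induction m with
    | zero => simp
    | succ m ih =>
      exact le_order_succ_of_isLittleO hf (ih (by omega))
        (h.trans_isLittleO (isLittleO_norm_pow (by omega)))
  exact this n le_rfl

theorem le_order_of_isLittleO {f : D → G} (hf : ContDiffAt ℝ ∞ f 0) {n : ℕ}
    (h : f =o[𝓝 0] fun x => ‖x‖ ^ n) : ((n + 1 : ℕ) : ℕ∞) ≤ order f 0 :=
  le_order_succ_of_isLittleO hf ((le_order_iff_isBigO hf).2 h.isBigO) h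

theorem order_le_order {G' : Type*} [NormedAddCommGroup G'] [NormedSpace ℝ G'] {f : D → G}
    {g : D → G'} (hf : ContDiffAt ℝ ∞ f 0) (hg : ContDiffAt ℝ ∞ g 0) (h : f =O[𝓝 0] g) :
    order g 0 ≤ order f 0 :=
  ENat.forall_natCast_le_iff_le.1 fun _ hn =>
    (le_order_iff_isBigO hf).2 (h.trans ((le_order_iff_isBigO hg).1 hn))

end Order

/-! ### Levi forms, composition with discs and logarithms -/

section Levi

variable {E : Type*} [NormedAddCommGroup E] [NormedSpace ℂ E]

theorem contDiffAt_two {f : E → ℝ} {z : E} (hf : ContDiffAt ℝ ∞ f z) : ContDiffAt ℝ 2 f z :=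
  hf.of_le (show ((2 : ℕ∞) : ℕ∞ω) ≤ ∞ from by exact_mod_cast le_top)

theorem differentiableAt_fderiv {f : E → ℝ} {z : E} (hf : ContDiffAt ℝ 2 f z) :
    DifferentiableAt ℝ (fderiv ℝ f) z :=
  (hf.fderiv_right (m := 1) (by norm_num)).differentiableAt (by simp)

theorem eventually_differentiableAt {f : E → ℝ} {z : E} (hf : ContDiffAt ℝ 2 f z) :
    ∀ᶠ y in 𝓝 z, DifferentiableAt ℝ f y :=
  (hf.eventually (by simp)).mono fun _ hy => hy.differentiableAt (by simp)

theorem fderiv_fderiv_apply {f : E → ℝ} {z : E} (hf : ContDiffAt ℝ 2 f z) (t s : E) :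
    fderiv ℝ (fderiv ℝ f) z t s = fderiv ℝ (fun y => fderiv ℝ f y s) z t := by
  rw [fderiv_clm_apply (differentiableAt_fderiv hf) (differentiableAt_const s)]
  simp

theorem leviForm_add {f g : E → ℝ} {z : E} (hf : ContDiffAt ℝ 2 f z) (hg : ContDiffAt ℝ 2 g z)
    (t : E) : leviForm (f + g) z t = leviForm f z t + leviForm g z t := by
  have h : fderiv ℝ (f + g) =ᶠ[𝓝 z] fderiv ℝ f + fderiv ℝ g := by
    filter_upwards [eventually_differentiableAt hf, eventually_differentiableAt hg] with y h1 h2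
    exact fderiv_add h1 h2
  unfold leviForm
  rw [h.fderiv_eq, fderiv_add (differentiableAt_fderiv hf) (differentiableAt_fderiv hg)]
  simp only [add_apply]
  ring

theorem leviForm_const (c : ℝ) (z t : E) : leviForm (fun _ => c) z t = 0 := by
  have : fderiv ℝ (fun _ : E => c) = fun _ => 0 := by ext1 y; simp
  simp [leviForm, this]

theorem leviForm_sub_const {f : E → ℝ} {z : E} (c : ℝ) (t : E) :
    leviForm (fun y => f y - c) z t = leviForm f z t := by
  have : fderiv ℝ (fun y => f y - c) = fderiv ℝ f := by ext1 y; rw [fderiv_sub_const]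
  simp [leviForm, this]

theorem leviForm_sum {ι : Type*} (s : Finset ι) {f : ι → E → ℝ} {z : E}
    (hf : ∀ i ∈ s, ContDiffAt ℝ 2 (f i) z) (t : E) :
    leviForm (fun y => ∑ i ∈ s, f i y) z t = ∑ i ∈ s, leviForm (f i) z t := by
  classical
  induction s using Finset.induction_on with
  | empty => simpa using leviForm_const 0 z t
  | insert a s ha ih =>
    simp only [Finset.sum_insert ha]
    rw [← ih fun i hi => hf i (Finset.mem_insert_of_mem hi)]
    exact leviForm_add (hf a (Finset.mem_insert_self _ _))
      (ContDiffAt.sum fun i hi => hf i (Finset.mem_insert_of_mem hi)) t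

/-- The second derivative in direction `s` contains the extra term `Df(s² φ'')`; the contributions
of `s = t` and `s = I t` cancel. -/
theorem leviForm_comp [CompleteSpace E] {f : E → ℝ} {φ : ℂ → E} {ζ : ℂ}
    (hf : ContDiffAt ℝ 2 f (φ ζ)) (hφ : AnalyticAt ℂ φ ζ) (t : ℂ) :
    leviForm (fun ξ => f (φ ξ)) ζ t = leviForm f (φ ζ) (t • deriv φ ζ) := by
  have hd : ∀ ξ, DifferentiableAt ℂ φ ξ → HasFDerivAt φ
      ((ContinuousLinearMap.toSpanSingleton ℂ (deriv φ ξ)).restrictScalars ℝ) ξ := by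
    intro ξ h
    exact h.hasDerivAt.hasFDerivAt.restrictScalars ℝ
  have hφ2 : ContDiffAt ℝ 2 φ ζ := hφ.contDiffAt.restrict_scalars ℝ
  have hF : ContDiffAt ℝ 2 (fun ξ => f (φ ξ)) ζ := hf.comp ζ hφ2
  have h1 : ∀ s : ℂ, (fun ξ => fderiv ℝ (fun ξ => f (φ ξ)) ξ s) =ᶠ[𝓝 ζ]
      fun ξ => fderiv ℝ f (φ ξ) (s • deriv φ ξ) := by
    intro s
    filter_upwards [hφ.eventually_analyticAt,
      hφ.continuousAt.eventually (eventually_differentiableAt hf)] with ξ ha hfd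
    have := (hfd.hasFDerivAt.comp ξ (hd ξ ha.differentiableAt)).fderiv
    simp only [Function.comp_def] at this
    rw [this]
    simp
  have h2 : ∀ s : ℂ, fderiv ℝ (fderiv ℝ (fun ξ => f (φ ξ))) ζ s s
      = fderiv ℝ (fderiv ℝ f) (φ ζ) (s • deriv φ ζ) (s • deriv φ ζ)
        + fderiv ℝ f (φ ζ) ((s * s) • deriv (deriv φ) ζ) := by
    intro s
    rw [fderiv_fderiv_apply hF, (h1 s).fderiv_eq]
    have ha := (differentiableAt_fderiv hf).hasFDerivAt.comp ζ (hd ζ hφ.differentiableAt)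
    have hb := ((hφ.deriv.differentiableAt.hasDerivAt.hasFDerivAt.restrictScalars ℝ).const_smul s)
    have := (ha.clm_apply hb).fderiv
    simp only [Function.comp_def] at this
    refine (congrArg (fun T => T s) this).trans ?_
    simp [smul_smul, add_comm]
  simp only [leviForm, h2, smul_smul, smul_eq_mul]
  have : Complex.I * t * (Complex.I * t) = - (t * t) := by
    linear_combination (t * t) * Complex.I_mul_I
  rw [this, neg_smul, map_neg]
  ring

/-- This is the Levi form of `log h` multiplied by `4 h²`, since `(log h)'' = h''/h - (h')²/h²`. -/
theorem sq_fderiv_le_of_log_psh {h : E → ℝ} {z t : E} (hh : ContDiffAt ℝ 2 h z) (hz : 0 < h z)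
    (hlog : 0 ≤ leviForm (fun y => Real.log (h y)) z t) :
    fderiv ℝ h z t ^ 2 + fderiv ℝ h z (Complex.I • t) ^ 2 ≤ 4 * h z * leviForm h z t := by
  have hl : ContDiffAt ℝ 2 (fun y => Real.log (h y)) z := hh.log hz.ne'
  have h2 : ∀ s : E, fderiv ℝ (fderiv ℝ (fun y => Real.log (h y))) z s s
      = (h z)⁻¹ * fderiv ℝ (fderiv ℝ h) z s s - (fderiv ℝ h z s) ^ 2 / h z ^ 2 := by
    intro s
    have h1 : (fun y => fderiv ℝ (fun y => Real.log (h y)) y s) =ᶠ[𝓝 z]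
        fun y => (h y)⁻¹ * fderiv ℝ h y s := by
      filter_upwards [eventually_differentiableAt hh,
        hh.continuousAt.eventually (lt_mem_nhds hz)] with y hy hpos
      rw [fderiv.log hy (ne_of_gt hpos)]
      simp
    rw [fderiv_fderiv_apply hl, h1.fderiv_eq]
    have hd := (hh.differentiableAt (by simp)).hasFDerivAt
    have ha := (hasDerivAt_inv hz.ne').comp_hasFDerivAt z hd
    have hb := (differentiableAt_fderiv hh).hasFDerivAt.clm_apply (hasFDerivAt_const s z)
    have := (ha.mul hb).fderiv
    refine (congrArg (fun T => T s) this).trans ?_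
    simp
    field_simp
    ring
  unfold leviForm at hlog ⊢
  rw [h2, h2] at hlog
  have hlog' := mul_nonneg hlog (by positivity : 0 ≤ 4 * h z ^ 2)
  have e : ((h z)⁻¹ * fderiv ℝ (fderiv ℝ h) z t t - (fderiv ℝ h z t) ^ 2 / h z ^ 2
    + ((h z)⁻¹ * fderiv ℝ (fderiv ℝ h) z (Complex.I • t) (Complex.I • t)
      - (fderiv ℝ h z (Complex.I • t)) ^ 2 / h z ^ 2)) / 4 * (4 * h z ^ 2)
    = h z * (fderiv ℝ (fderiv ℝ h) z t t + fderiv ℝ (fderiv ℝ h) z (Complex.I • t) (Complex.I • t))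
      - (fderiv ℝ h z t ^ 2 + fderiv ℝ h z (Complex.I • t) ^ 2) := by
    field_simp
    ring
  rw [e] at hlog'
  linarith

end Levi

/-! ### Non-cancellation of leading parts, and orders controlled by a Laplacian -/

section NoCancellation

theorem isBigO_leviForm {F : ℂ → ℝ} (hF : ContDiffAt ℝ ∞ F 0) {n : ℕ}
    (h : ((n + 2 : ℕ) : ℕ∞) ≤ order F 0) (t : ℂ) :
    (fun ζ => leviForm F ζ t) =O[𝓝 0] fun ζ => ‖ζ‖ ^ n := by
  have h2 := (le_order_succ_iff_fderiv.1 (le_order_succ_iff_fderiv.1 h).2).2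
  have hb := isBigO_of_le_order n (contDiffAt_fderiv (contDiffAt_fderiv hF)) h2
  have key : ∀ s : ℂ, (fun ζ => fderiv ℝ (fderiv ℝ F) ζ s s) =O[𝓝 0] fun ζ => ‖ζ‖ ^ n := by
    intro s
    refine IsBigO.trans (IsBigO.of_bound (‖s‖ * ‖s‖) (Eventually.of_forall fun ζ => ?_)) hb
    refine (ContinuousLinearMap.le_opNorm₂ _ s s).trans (le_of_eq (by ring))
  simp only [leviForm, div_eq_inv_mul]
  exact ((key t).add (key _)).const_mul_left _

/-- A non-negative homogeneous superharmonic function on the plane vanishes on `ℂ ∖ {0}`. -/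
theorem homogeneous_superharmonic_eq_zero {Q : ℂ → ℝ} {n : ℕ} (hn : n ≠ 0) (hQ : ContDiff ℝ ∞ Q)
    (hhom : ∀ (t : ℝ) x, 0 < t → Q (t • x) = t ^ n • Q x) (hpos : ∀ x, 0 ≤ Q x)
    (hlevi : ∀ x t, leviForm Q x t ≤ 0) (ζ : ℂ) : Q (Complex.exp ζ) = 0 := by
  -- In logarithmic coordinates homogeneity reads `V (ξ + s) = e^{ns} V ξ`, so the second
  -- real-direction derivative is `n² V`; superharmonicity then bounds the second angular derivative
  -- by `-n² V ≤ 0`.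
  set V : ℂ → ℝ := fun ξ => Q (Complex.exp ξ) with hV
  have hVs : ContDiff ℝ ∞ V := hQ.comp ((Complex.contDiff_exp (𝕜 := ℂ)).restrict_scalars ℝ)
  have hV2 : ∀ ξ, ContDiffAt ℝ 2 V ξ := fun ξ => contDiffAt_two hVs.contDiffAt
  have hVd : ∀ ξ, HasFDerivAt V (fderiv ℝ V ξ) ξ := fun ξ =>
    ((hV2 ξ).differentiableAt (by simp)).hasFDerivAt
  have hVdd : ∀ ξ, HasFDerivAt (fderiv ℝ V) (fderiv ℝ (fderiv ℝ V) ξ) ξ := fun ξ =>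
    (differentiableAt_fderiv (hV2 ξ)).hasFDerivAt
  have hadd : ∀ (ξ : ℂ) (s : ℝ), V (ξ + s) = Real.exp s ^ n * V ξ := by
    intro ξ s
    rw [← smul_eq_mul, hV]
    simp only
    rw [← hhom _ _ (Real.exp_pos s), Complex.exp_add, Complex.real_smul, Complex.ofReal_exp, mul_comm]
  have h1 : (fun ξ => fderiv ℝ V ξ 1) = fun ξ => (n : ℝ) * V ξ := by
    ext ξ
    have ha : HasDerivAt (fun s : ℝ => V (ξ + s)) (fderiv ℝ V ξ 1) 0 := by
      have hc : HasDerivAt (fun s : ℝ => ξ + (s : ℂ)) 1 0 :=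
        (Complex.ofRealCLM.hasDerivAt (x := 0)).const_add ξ
      have := hVd (ξ + ((0 : ℝ) : ℂ))
      have h' := this.comp_hasDerivAt (0 : ℝ) hc
      rw [Complex.ofReal_zero, add_zero] at h'
      exact h'
    have hb : HasDerivAt (fun s : ℝ => V (ξ + s)) ((n : ℝ) * V ξ) 0 := by
      have := ((Real.hasDerivAt_exp 0).pow n).mul_const (V ξ)
      refine (this.congr_deriv (by simp)).congr_of_eventuallyEq ?_
      exact Eventually.of_forall fun s => hadd ξ s
    exact ha.unique hb
  have h11 : ∀ ξ, fderiv ℝ (fderiv ℝ V) ξ 1 1 = (n : ℝ) ^ 2 * V ξ := by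
    intro ξ
    rw [fderiv_fderiv_apply (hV2 ξ), h1, fderiv_const_mul (hVd ξ).differentiableAt]
    have := congrFun h1 ξ
    simp only [smul_apply, this, smul_eq_mul]
    ring
  have hsup : ∀ ξ, (n : ℝ) ^ 2 * V ξ + fderiv ℝ (fderiv ℝ V) ξ Complex.I Complex.I ≤ 0 := by
    intro ξ
    have := leviForm_comp (f := Q) (φ := Complex.exp) (ζ := ξ)
      (contDiffAt_two hQ.contDiffAt) analyticAt_cexp 1
    have h' : leviForm V ξ 1 ≤ 0 := this.trans_le (hlevi _ _)
    unfold leviForm at h'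
    rw [h11] at h'
    simp only [smul_eq_mul, mul_one] at h'
    linarith
  have hc : ∀ θ : ℝ, HasDerivAt (fun s : ℝ => ζ + s * Complex.I) Complex.I θ := by
    intro θ
    simpa using ((Complex.ofRealCLM.hasDerivAt (x := θ)).mul_const Complex.I).const_add ζ
  set q' : ℝ → ℝ := fun θ => fderiv ℝ V (ζ + θ * Complex.I) Complex.I with hq'
  have hq'' : ∀ θ : ℝ, HasDerivAt q'
      (fderiv ℝ (fderiv ℝ V) (ζ + θ * Complex.I) Complex.I Complex.I) θ := by
    intro θ
    have := ((hVdd _).clm_apply (hasFDerivAt_const Complex.I _)).comp_hasDerivAt θ (hc θ)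
    simpa [Function.comp_def] using this
  have hVpos : ∀ ξ, 0 ≤ V ξ := fun ξ => hpos _
  have hanti : Antitone q' := by
    refine antitone_of_deriv_nonpos (fun θ => (hq'' θ).differentiableAt) fun θ => ?_
    rw [(hq'' θ).deriv]
    have := hsup (ζ + θ * Complex.I)
    have := mul_nonneg (sq_nonneg (n : ℝ)) (hVpos (ζ + θ * Complex.I))
    linarith
  have hper : Function.Periodic q' (2 * Real.pi) := by
    intro θ
    have hVper : (fun ξ => V (ξ + 2 * Real.pi * Complex.I)) = V := by
      ext ξ
      simp only [hV, Complex.exp_periodic ξ]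
    have h := fderiv_comp_add_right (𝕜 := ℝ) (f := V) (x := ζ + θ * Complex.I)
      (2 * Real.pi * Complex.I)
    rw [hVper] at h
    simp only [hq']
    rw [h]
    congr 2
    push_cast
    ring
  -- An antitone periodic function is constant. Hence the second angular derivative is zero, and `n²
  -- V ≤ 0` remains.
  have hconst : ∀ θ, q' θ = q' 0 := by
    have hle : ∀ a b, q' a ≤ q' b := by
      intro a b
      obtain ⟨m, hm⟩ := exists_nat_ge ((b - a) / (2 * Real.pi))
      rw [div_le_iff₀ (by positivity)] at hm
      have hp : q' b = q' (b - m * (2 * Real.pi)) := (hper.sub_nat_mul_eq m).symm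
      rw [hp]
      exact hanti (by linarith)
    exact fun θ => le_antisymm (hle _ _) (hle _ _)
  have hz : fderiv ℝ (fderiv ℝ V) (ζ + (0 : ℝ) * Complex.I) Complex.I Complex.I = 0 := by
    have : q' = fun _ => q' 0 := funext hconst
    have h' := hq'' 0
    rw [this] at h'
    exact h'.unique (hasDerivAt_const _ _)
  have h0 := hsup (ζ + (0 : ℝ) * Complex.I)
  rw [hz] at h0
  simp only [Complex.ofReal_zero, zero_mul, add_zero] at h0
  have hn2 : 0 < (n : ℝ) ^ 2 := by positivity
  exact le_antisymm (by nlinarith [hVpos ζ]) (hVpos ζ)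

/-- The leading part of a subharmonic function is not cancelled by that of a non-negative one. -/
theorem le_order_of_le_order_add {f g : ℂ → ℝ} (hf : ContDiffAt ℝ ∞ f 0)
    (hg : ContDiffAt ℝ ∞ g 0) (hlevi : ∀ᶠ ζ in 𝓝 0, ∀ t, 0 ≤ leviForm f ζ t)
    (hpos : ∀ᶠ ζ in 𝓝 0, 0 ≤ g ζ) (hg0 : g 0 = 0) {n : ℕ}
    (h : (n : ℕ∞) ≤ order (f + g) 0) : (n : ℕ∞) ≤ order g 0 := by
  induction n with
  | zero => simp
  | succ n ih =>
    have hgn := ih (le_trans (by exact_mod_cast n.le_succ) h)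
    obtain ⟨Q, hQ, hhom, hord⟩ := exists_leading_part hg hgn
    -- Degree zero is covered by `g 0 = 0`; the argument on leading parts needs positive degree.
    rcases Nat.eq_zero_or_pos n with rfl | hn
    · exact le_order_succ_iff_fderiv.2 ⟨hg0, by simp⟩
    obtain ⟨k, rfl⟩ : ∃ k, n = k + 1 := ⟨n - 1, by omega⟩
    have hray : ∀ x : ℂ, Tendsto (fun t : ℝ => t • x) (𝓝[>] 0) (𝓝 0) := by
      intro x
      have : Tendsto (fun t : ℝ => t • x) (𝓝 0) (𝓝 ((0 : ℝ) • x)) :=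
        (continuous_id.smul continuous_const).tendsto _
      rw [zero_smul] at this
      exact this.mono_left nhdsWithin_le_nhds
    have h0lim : ∀ c : ℝ, Tendsto (fun t : ℝ => t * c) (𝓝[>] 0) (𝓝 0) := by
      intro c
      have : Tendsto (fun t : ℝ => t * c) (𝓝 0) (𝓝 (0 * c)) :=
        (continuous_id.mul continuous_const).tendsto _
      rw [zero_mul] at this
      exact this.mono_left nhdsWithin_le_nhds
    have hQpos : ∀ x, 0 ≤ Q x := by
      intro x
      obtain ⟨C, hC⟩ := (isBigO_of_le_order _ (hg.sub hQ.contDiffAt) hord).bound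
      refine le_of_tendsto (h0lim (-(C * ‖x‖ ^ (k + 1 + 1)))) ?_
      filter_upwards [(hray x).eventually (hC.and hpos), self_mem_nhdsWithin] with t ht ht0
      have ht0 : (0 : ℝ) < t := ht0
      have h1 := ht.1
      rw [hhom t x ht0, norm_pow, norm_norm, norm_smul, Real.norm_of_nonneg ht0.le, smul_eq_mul,
        mul_pow] at h1
      have h2 := (le_abs_self _).trans h1
      have h3 : t ^ (k + 1) * (t * -(C * ‖x‖ ^ (k + 1 + 1))) ≤ t ^ (k + 1) * Q x := by
        have := ht.2
        have e : t ^ (k + 1) * (t * -(C * ‖x‖ ^ (k + 1 + 1)))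
          = - (C * (t ^ (k + 1 + 1) * ‖x‖ ^ (k + 1 + 1))) := by ring
        rw [e]; linarith
      exact le_of_mul_le_mul_left h3 (by positivity)
    have hgQ : ContDiffAt ℝ ∞ (g - Q) 0 := hg.sub hQ.contDiffAt
    have hfQs : ContDiffAt ℝ ∞ (f + Q) 0 := hf.add hQ.contDiffAt
    have hfg : ContDiffAt ℝ ∞ (f + g) 0 := hf.add hg
    have hQ2 : ∀ x, ContDiffAt ℝ 2 Q x := fun x => contDiffAt_two hQ.contDiffAt
    -- `f + Q = (f + g) - (g - Q)` has order at least `k + 2`, so its Levi form is `O(|ζ|^k)`. As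
    -- that of `f` is non-negative, the Levi form of `Q` at `t x` is at most `C t^k |x|^k`; but it
    -- scales like `t^(k-1)`, so letting `t → 0` gives the sign. The scaling is written with `t ^ 2`
    -- on the left to cover `k = 0`.
    have hQlevi : ∀ x t, leviForm Q x t ≤ 0 := by
      intro x s
      have hfQ : ((k + 2 : ℕ) : ℕ∞) ≤ order (f + Q) 0 := by
        have := order_sub_le hfg hgQ h hord
        have e : f + g - (g - Q) = f + Q := by abel
        rwa [e] at this
      obtain ⟨C, hC⟩ := (isBigO_leviForm hfQs hfQ s).bound
      have hscale : ∀ t : ℝ, 0 < t → t ^ 2 * leviForm Q (t • x) s = t ^ (k + 1) * leviForm Q x s := by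
        intro t ht
        have h1 : ∀ y, t • fderiv ℝ Q (t • y) = t ^ (k + 1) • fderiv ℝ Q y := by
          intro y
          rw [← fderiv_comp_smul (𝕜 := ℝ), show (fun y => Q (t • y)) = t ^ (k + 1) • Q from
            funext fun y => hhom t y ht, fderiv_const_smul_field]
          rfl
        have h2 : t ^ 2 • fderiv ℝ (fderiv ℝ Q) (t • x) = t ^ (k + 1) • fderiv ℝ (fderiv ℝ Q) x := by
          have e : (fun y => t • fderiv ℝ Q (t • y)) = fun y => t ^ (k + 1) • fderiv ℝ Q y := funext h1
          have hd : ∀ y, HasFDerivAt (fderiv ℝ Q) (fderiv ℝ (fderiv ℝ Q) y) y := fun y =>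
            (differentiableAt_fderiv (hQ2 y)).hasFDerivAt
          have hl := ((hd (t • x)).comp x ((hasFDerivAt_id x).const_smul t)).const_smul t
          have hr : HasFDerivAt (fun y => t ^ (k + 1) • fderiv ℝ Q y)
              (t ^ (k + 1) • fderiv ℝ (fderiv ℝ Q) x) x := (hd x).const_smul (t ^ (k + 1))
          rw [← e] at hr
          rw [← hl.unique hr]
          ext
          simp [sq, mul_assoc]
        have h3 : ∀ v : ℂ, t ^ 2 * fderiv ℝ (fderiv ℝ Q) (t • x) v v
            = t ^ (k + 1) * fderiv ℝ (fderiv ℝ Q) x v v := fun v => by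
          simpa using congrArg (fun T => T v v) h2
        simp only [leviForm]
        linear_combination (h3 s + h3 (Complex.I • s)) / 4
      refine ge_of_tendsto (h0lim (C * ‖x‖ ^ k)) ?_
      filter_upwards [(hray x).eventually (hC.and (hlevi.and (eventually_contDiffAt hf 2))),
        self_mem_nhdsWithin] with t ⟨ht, htl, htf⟩ ht0
      have ht0 : (0 : ℝ) < t := ht0
      rw [leviForm_add (by exact_mod_cast htf) (hQ2 _)] at ht
      have h2 := (le_abs_self _).trans ht
      have h3 := htl s
      rw [norm_pow, norm_norm, norm_smul, Real.norm_of_nonneg ht0.le, mul_pow] at h2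
      have h4 : leviForm Q (t • x) s ≤ C * (t ^ k * ‖x‖ ^ k) := by linarith
      have h5 := mul_le_mul_of_nonneg_left h4 (by positivity : 0 ≤ t ^ 2)
      rw [hscale t ht0] at h5
      have h6 : t ^ (k + 1) * leviForm Q x s ≤ t ^ (k + 1) * (t * (C * ‖x‖ ^ k)) := by
        refine h5.trans (le_of_eq (by ring))
      exact le_of_mul_le_mul_left h6 (by positivity)
    have hQ0 : Q = 0 := by
      ext x
      by_cases hx : x = 0
      · have := le_order_of_homogeneous _ hhom
        rw [hx, (le_order_succ_iff_fderiv.1 this).1]; rfl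
      · have := homogeneous_superharmonic_eq_zero (by omega) hQ hhom hQpos hQlevi (Complex.log x)
        rwa [Complex.exp_log hx] at this
    rwa [hQ0, sub_zero] at hord

theorem order_add_le_right {f g : ℂ → ℝ} (hf : ContDiffAt ℝ ∞ f 0)
    (hg : ContDiffAt ℝ ∞ g 0) (hlevi : ∀ᶠ ζ in 𝓝 0, ∀ t, 0 ≤ leviForm f ζ t)
    (hpos : ∀ᶠ ζ in 𝓝 0, 0 ≤ g ζ) (hg0 : g 0 = 0) : order (f + g) 0 ≤ order g 0 :=
  ENat.forall_natCast_le_iff_le.1 fun _ hn => le_order_of_le_order_add hf hg hlevi hpos hg0 hn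

theorem order_add_le_left {f g : ℂ → ℝ} (hf : ContDiffAt ℝ ∞ f 0)
    (hg : ContDiffAt ℝ ∞ g 0) (hlevi : ∀ᶠ ζ in 𝓝 0, ∀ t, 0 ≤ leviForm f ζ t)
    (hpos : ∀ᶠ ζ in 𝓝 0, 0 ≤ g ζ) (hg0 : g 0 = 0) : order (f + g) 0 ≤ order f 0 := by
  refine ENat.forall_natCast_le_iff_le.1 fun n hn => ?_
  have := order_sub_le (f := f + g) (hf.add hg) hg hn (le_order_of_le_order_add hf hg hlevi hpos hg0 hn)
  rwa [add_sub_cancel_right] at this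

/-- If the square of the derivative of `ψ` is controlled by the Laplacian of `F`, then the order
of `F` is at most twice the order of `ψ`. -/
theorem order_le_two_mul_order {W : Type*} [NormedAddCommGroup W] [NormedSpace ℝ W] {F : ℂ → ℝ}
    {ψ : ℂ → W} (hF : ContDiffAt ℝ ∞ F 0) (hψ : ContDiffAt ℝ ∞ ψ 0) (hψ0 : ψ 0 = 0) {C : ℝ}
    (h : ∀ᶠ ζ in 𝓝 0, ‖fderiv ℝ ψ ζ‖ ^ 2 ≤ C * leviForm F ζ 1) :
    order F 0 ≤ 2 * order ψ 0 := by
  -- For `m ≥ 1` the Levi form is `O(|ζ|^(2m-1))`, so `‖ψ'‖` is `O(|ζ|^(m-1/2))`, in particular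
  -- `o(|ζ|^(m-1))`; since orders are integers, `ψ'` has order at least `m`.
  have key : ∀ m : ℕ, ((2 * m + 1 : ℕ) : ℕ∞) ≤ order F 0 → ((m + 1 : ℕ) : ℕ∞) ≤ order ψ 0 := by
    rintro (_ | k) hk
    · exact le_order_succ_iff_fderiv.2 ⟨hψ0, by simp⟩
    · refine le_order_succ_iff_fderiv.2 ⟨hψ0, le_order_of_isLittleO (contDiffAt_fderiv hψ) ?_⟩
      have hL := isBigO_leviForm hF (n := 2 * k + 1) hk 1
      have h1 : (fun ζ => ‖fderiv ℝ ψ ζ‖ ^ 2) =O[𝓝 0] fun ζ => ‖ζ‖ ^ (2 * k + 1) := by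
        refine IsBigO.trans (IsBigO.of_bound |C| ?_) hL
        filter_upwards [h] with ζ hζ
        rw [norm_pow, norm_norm, Real.norm_eq_abs, ← abs_mul]
        exact hζ.trans (le_abs_self _)
      have h2 := h1.trans_isLittleO (isLittleO_norm_pow (m := 2 * k) (by omega))
      have h3 : (fun ζ => ‖fderiv ℝ ψ ζ‖) =o[𝓝 0] fun ζ : ℂ => ‖ζ‖ ^ k := by
        refine IsLittleO.of_pow (n := 2) ?_ (by norm_num)
        simpa only [pow_mul', Pi.pow_def] using h2
      exact h3.of_norm_left
  by_contra hlt
  push Not at hlt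
  have hne : order ψ 0 ≠ ⊤ := by
    rintro h'
    rw [h'] at hlt
    simp at hlt
  obtain ⟨m, hm⟩ := ENat.ne_top_iff_exists.1 hne
  rw [← hm] at hlt
  have := key m (by
    have := Order.add_one_le_of_lt hlt
    exact_mod_cast this)
  rw [← hm] at this
  have : m + 1 ≤ m := by exact_mod_cast this
  omega

end NoCancellation

/-! ### Independence of the type from the defining function -/

section DefiningFunction

variable {E : Type*} [NormedAddCommGroup E] [NormedSpace ℂ E]

theorem IsLocalDefiningFunction.contDiffAt {Ω : Set E} {x : E} {r : E → ℝ}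
    (h : IsLocalDefiningFunction Ω x r) : ContDiffAt ℝ ∞ r x := by
  obtain ⟨_, _, U, hU, hx, hr, _⟩ := h
  exact hr.contDiffAt (hU.mem_nhds hx)

/-- Two local defining functions at the same boundary point are comparable. -/
theorem IsLocalDefiningFunction.isBigO {Ω : Set E} {x : E} {r₁ r₂ : E → ℝ}
    (h₁ : IsLocalDefiningFunction Ω x r₁) (h₂ : IsLocalDefiningFunction Ω x r₂) :
    r₂ =O[𝓝 x] r₁ := by
  have hc₁ := h₁.contDiffAt
  have hs₁ := hc₁.hasStrictFDerivAt (by simp)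
  have hs₂ := h₂.contDiffAt.hasStrictFDerivAt (by simp)
  obtain ⟨h0, hd, U₁, hU₁, hx₁, hr₁, hm₁⟩ := h₁
  obtain ⟨-, -, U₂, hU₂, hx₂, hr₂, hm₂⟩ := h₂
  obtain ⟨v, hv⟩ : ∃ v, fderiv ℝ r₁ x v = 1 := by
    obtain ⟨w, hw⟩ : ∃ w, fderiv ℝ r₁ x w ≠ 0 := by
      by_contra hcon
      push Not at hcon
      exact hd (ContinuousLinearMap.ext hcon)
    exact ⟨(fderiv ℝ r₁ x w)⁻¹ • w, by simp [hw]⟩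
  obtain ⟨K, hK⟩ := hs₂.isBigO_sub.bound
  -- With this constant, a move by `t v` changes `r₁` by `t` up to an error of at most `|t| / 2`.
  have hK₁ := hs₁.isLittleO.bound (c := (2 * (‖v‖ + 1))⁻¹) (by positivity)
  obtain ⟨ε, hε, hball⟩ := Metric.eventually_nhds_iff_ball.1 ((hK₁.and hK).and
    ((continuousAt_fst (p := (x, x))).eventually
      ((hU₁.eventually_mem hx₁).and (hU₂.eventually_mem hx₂))))
  have hdiff : ∀ y ∈ Metric.ball x ε, ∀ t : ℝ, y + t • v ∈ Metric.ball x ε →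
      |r₁ (y + t • v) - r₁ y - t| ≤ |t| / 2 ∧ |r₂ (y + t • v) - r₂ y| ≤ K * (|t| * ‖v‖) := by
    intro y hy t hyt
    obtain ⟨⟨h1, h2⟩, -⟩ := hball (y + t • v, y) (by
      rw [← ball_prod_same]; exact ⟨hyt, hy⟩)
    simp only [add_sub_cancel_left, map_smul, hv, smul_eq_mul, mul_one, norm_smul,
      Real.norm_eq_abs] at h1 h2
    refine ⟨h1.trans ?_, h2⟩
    rw [inv_mul_eq_div, div_le_div_iff₀ (by positivity) (by positivity)]
    nlinarith [abs_nonneg t, norm_nonneg v]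
  have hmem : ∀ y ∈ Metric.ball x ε, y ∈ U₁ ∧ y ∈ U₂ := fun y hy =>
    (hball (y, y) (by rw [← ball_prod_same]; exact ⟨hy, hy⟩)).2
  -- Moving from a zero of `r₁` along `-v` enters the domain, so `r₂ ≤ 0` in the limit; `r₂ < 0`
  -- would put the zero itself in the domain.
  have hzero : ∀ y ∈ Metric.ball x ε, r₁ y = 0 → r₂ y = 0 := by
    intro y hy hy0
    obtain ⟨hy₁, hy₂⟩ := hmem y hy
    refine le_antisymm ?_ (not_lt.1 fun hlt => ?_)
    · have hlim : Tendsto (fun t : ℝ => y + t • v) (𝓝[<] 0) (𝓝 y) := by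
        have : Tendsto (fun t : ℝ => y + t • v) (𝓝 0) (𝓝 (y + (0 : ℝ) • v)) :=
          (continuous_const.add (continuous_id.smul continuous_const)).tendsto _
        rw [zero_smul, add_zero] at this
        exact this.mono_left nhdsWithin_le_nhds
      have hc := (hr₂.contDiffAt (hU₂.mem_nhds hy₂)).continuousAt
      refine le_of_tendsto (hc.tendsto.comp hlim) ?_
      filter_upwards [hlim.eventually (Metric.isOpen_ball.mem_nhds hy), self_mem_nhdsWithin]
        with t ht ht0
      have ht0 : t < 0 := ht0
      have h1 := (abs_le.1 (hdiff y hy t ht).1).2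
      rw [hy0, abs_of_neg ht0] at h1
      obtain ⟨ht₁, ht₂⟩ := hmem _ ht
      exact ((hm₂ _ ht₂).1 ((hm₁ _ ht₁).2 (by linarith))).le
    · have := (hm₁ y hy₁).1 ((hm₂ y hy₂).2 hlt)
      linarith
  -- As `r₁` changes by at least half of `|t|`, a zero of `r₁` lies within `|t| ≤ 2 |r₁ y|` along
  -- `v`. There `r₂` vanishes too, and its Lipschitz bound controls `r₂ y`. The condition keeps this
  -- segment in the ball.
  have hev : ∀ᶠ y in 𝓝 x, ‖y - x‖ + 2 * |r₁ y| * ‖v‖ < ε := by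
    have hc : ContinuousAt (fun y => ‖y - x‖ + 2 * |r₁ y| * ‖v‖) x :=
      (continuousAt_id.sub continuousAt_const).norm.add
        ((continuousAt_const.mul hc₁.continuousAt.abs).mul continuousAt_const)
    exact hc.eventually_lt_const (by simpa [h0] using hε)
  refine IsBigO.of_bound (2 * |K| * ‖v‖) ?_
  filter_upwards [hev] with y hy
  have hin : ∀ t : ℝ, |t| ≤ 2 * |r₁ y| → y + t • v ∈ Metric.ball x ε := by
    intro t ht
    rw [mem_ball_iff_norm, add_sub_right_comm]
    refine (norm_add_le _ _).trans_lt (lt_of_le_of_lt ?_ hy)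
    rw [norm_smul, Real.norm_eq_abs]
    gcongr
  have hyb : y ∈ Metric.ball x ε := by simpa using hin 0 (by simp)
  set s := |r₁ y|
  have hs0 : 0 ≤ s := abs_nonneg _
  have hcont : ContinuousOn (fun t : ℝ => r₁ (y + t • v)) (Set.Icc (-(2 * s)) (2 * s)) := by
    intro t ht
    have := (hr₁.contDiffAt (hU₁.mem_nhds (hmem _ (hin t (abs_le.2 ht))).1)).continuousAt
    exact (this.comp (f := fun t : ℝ => y + t • v) (by fun_prop)).continuousWithinAt
  have hend₁ := (abs_le.1 (hdiff y hyb _ (hin (-(2 * s)) (by simp [abs_of_nonneg hs0]))).1).2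
  have hend₂ := (abs_le.1 (hdiff y hyb _ (hin (2 * s) (by simp [abs_of_nonneg hs0]))).1).1
  rw [abs_neg, abs_of_nonneg (by positivity)] at hend₁
  rw [abs_of_nonneg (by positivity)] at hend₂
  obtain ⟨t, ht, ht0⟩ := intermediate_value_Icc (by linarith) hcont
    (show (0 : ℝ) ∈ Set.Icc _ _ from ⟨by linarith [le_abs_self (r₁ y)],
      by linarith [neg_abs_le (r₁ y)]⟩)
  have htb := hin t (abs_le.2 ht)
  have h2 := (hdiff y hyb t htb).2
  rw [hzero _ htb ht0, zero_sub, abs_neg] at h2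
  rw [Real.norm_eq_abs, Real.norm_eq_abs]
  calc |r₂ y| ≤ K * (|t| * ‖v‖) := h2
    _ ≤ |K| * (2 * s * ‖v‖) := by
        gcongr
        · exact le_abs_self K
        · exact abs_le.2 ht
    _ = 2 * |K| * ‖v‖ * s := by ring

theorem IsDiscAt.analyticAt [CompleteSpace E] {φ : ℂ → E} {z : E} (h : IsDiscAt φ z) :
    AnalyticAt ℂ φ 0 :=
  h.holomorphic.analyticAt (Metric.ball_mem_nhds 0 one_pos)

theorem IsDiscAt.contDiffAt [CompleteSpace E] {φ : ℂ → E} {z : E} (h : IsDiscAt φ z) :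
    ContDiffAt ℝ ∞ φ 0 :=
  h.analyticAt.contDiffAt.restrict_scalars ℝ

theorem IsDiscAt.contDiffAt_comp [CompleteSpace E] {φ : ℂ → E} {z : E} (h : IsDiscAt φ z)
    {r : E → ℝ} (hr : ContDiffAt ℝ ∞ r z) :
    ContDiffAt ℝ ∞ (fun ζ => r (φ ζ) - r z) 0 := by
  rw [← h.center] at hr
  exact (hr.comp 0 h.contDiffAt).sub contDiffAt_const

theorem IsLocalDefiningFunction.typ_le [CompleteSpace E] {Ω : Set E} {x : E} {r₁ r₂ : E → ℝ}
    (h₁ : IsLocalDefiningFunction Ω x r₁) (h₂ : IsLocalDefiningFunction Ω x r₂) :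
    typ r₁ x ≤ typ r₂ x := by
  refine iSup₂_mono fun φ hφ => ENNReal.div_le_div_right (ENat.toENNReal_le.2 ?_) _
  refine order_le_order (hφ.contDiffAt_comp h₂.contDiffAt) (hφ.contDiffAt_comp h₁.contDiffAt) ?_
  simp only [h₁.1, h₂.1, sub_zero]
  have hc : Tendsto φ (𝓝 0) (𝓝 x) := hφ.center ▸ hφ.contDiffAt.continuousAt.tendsto
  exact (h₁.isBigO h₂).comp_tendsto hc

theorem IsLocalDefiningFunction.typ_le_bdryTyp [CompleteSpace E] {Ω : Set E} {x : E} {r : E → ℝ}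
    (h : IsLocalDefiningFunction Ω x r) : typ r x ≤ bdryTyp Ω x :=
  le_iInf₂ fun _ h' => h.typ_le h'

theorem IsLocalDefiningFunction.bdryTyp_le {Ω : Set E} {x : E} {r : E → ℝ}
    (h : IsLocalDefiningFunction Ω x r) : bdryTyp Ω x ≤ typ r x :=
  iInf₂_le r h

theorem IsDefiningFunctionOn.eq_zero {Ω U : Set E} {ρ : E → ℝ} (h : IsDefiningFunctionOn Ω ρ U)
    (hΩ : IsOpen Ω) {x : E} (hx : x ∈ frontier Ω) : ρ x = 0 := by
  have hxU := h.closure_subset hx.1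
  have hc : ContinuousAt ρ x := (h.smooth.contDiffAt (h.isOpen.mem_nhds hxU)).continuousAt
  refine le_antisymm ?_ (not_lt.1 fun hlt => hx.2 (hΩ.interior_eq.symm ▸ (h.mem_iff x hxU).2 hlt))
  by_contra hpos
  obtain ⟨y, hyΩ, hyU, hy⟩ := ((mem_closure_iff_frequently.1 hx.1).and_eventually
    ((h.isOpen.eventually_mem hxU).and
      (hc.eventually (lt_mem_nhds (not_le.1 hpos))))).exists
  exact absurd ((h.mem_iff y hyU).1 hyΩ) (not_lt.2 (le_of_lt hy))

theorem IsDefiningFunctionOn.isLocalDefiningFunction {Ω U : Set E} {ρ : E → ℝ}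
    (h : IsDefiningFunctionOn Ω ρ U) (hΩ : IsOpen Ω) {x : E} (hx : x ∈ frontier Ω) :
    IsLocalDefiningFunction Ω x ρ :=
  ⟨h.eq_zero hΩ hx, h.gradient_ne_zero x hx, U, h.isOpen, h.closure_subset hx.1, h.smooth,
    h.mem_iff⟩

end DefiningFunction

/-! ### Connectedness of sublevel sets -/

section Sublevel

variable {V : Type*} [NormedAddCommGroup V] [NormedSpace ℝ V] [ProperSpace V]

/-- Sublevel sets of a proper function whose only critical point is `a` are connected. -/
theorem isPreconnected_sublevel {H : V → ℝ} (hH : Continuous H) {a : V} {c : ℝ}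
    (hb : Bornology.IsBounded {w | H w < c}) (hcrit : ∀ w, w ≠ a → fderiv ℝ H w ≠ 0) :
    IsPreconnected {w | H w < c} := by
  refine isPreconnected_of_forall a fun w hw => ?_
  set S := {w | H w < c}
  have hS : IsOpen S := isOpen_lt hH continuous_const
  set C := connectedComponentIn S w
  have hCS : C ⊆ S := connectedComponentIn_subset S w
  have hwC : w ∈ C := mem_connectedComponentIn hw
  have hCo : IsOpen C := hS.connectedComponentIn
  -- Each component `C` contains `a`: the minimum of `H` on `closure C` stays below `c`, so it lies
  -- in `C`, which is open, and is therefore a critical point.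
  have hK : IsCompact (closure C) := (hb.subset hCS).isCompact_closure
  obtain ⟨m, hm, hmin⟩ := hK.exists_isMinOn ⟨w, subset_closure hwC⟩ hH.continuousOn
  have hmS : m ∈ S := (show H m ≤ H w from hmin (subset_closure hwC)).trans_lt hw
  have hmC : m ∈ C := by
    have hp : IsPreconnected (insert m C) :=
      isPreconnected_connectedComponentIn.subset_closure (Set.subset_insert _ _)
        (Set.insert_subset hm subset_closure)
    exact hp.subset_connectedComponentIn (Set.mem_insert_of_mem _ hwC)
      (Set.insert_subset hmS hCS) (Set.mem_insert _ _)
  have hloc : IsLocalMin H m :=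
    (hmin.on_subset subset_closure).isLocalMin (hCo.mem_nhds hmC)
  have : m = a := by_contra fun hne => hcrit m hne hloc.fderiv_eq_zero
  exact ⟨C, hCS, this ▸ hmC, hwC, isPreconnected_connectedComponentIn⟩

end Sublevel

/-! ### The domain: defining function, smooth boundary, connectedness, boundedness -/

section Geometry

variable {E : Type*} [NormedAddCommGroup E] [NormedSpace ℂ E]
  {ι : Type*} [Fintype ι] {F : ι → Type*} [∀ i, NormedAddCommGroup (F i)]
  [∀ i, NormedSpace ℂ (F i)]

/-- The function `ρ (z) + ∑ i, h_i (w_i)`. -/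
def hartogsFun (ρ : E → ℝ) (h : ∀ i, F i → ℝ) (x : E × (∀ i, F i)) : ℝ :=
  ρ x.1 + ∑ i, h i (x.2 i)

/-- The projection `(z, w) ↦ w_i`. -/
def coord (E : Type*) [NormedAddCommGroup E] [NormedSpace ℂ E] (F : ι → Type*)
    [∀ i, NormedAddCommGroup (F i)] [∀ i, NormedSpace ℂ (F i)] (i : ι) :
    (E × (∀ i, F i)) →L[ℂ] F i :=
  (ContinuousLinearMap.proj i).comp (ContinuousLinearMap.snd ℂ E (∀ i, F i))

theorem coord_apply (i : ι) (x : E × (∀ i, F i)) : coord E F i x = x.2 i := rfl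

theorem contDiffAt_hartogsFun {ρ : E → ℝ} {h : ∀ i, F i → ℝ} (hh : ConditionII h)
    {x : E × (∀ i, F i)} (hρ : ContDiffAt ℝ ∞ ρ x.1) : ContDiffAt ℝ ∞ (hartogsFun ρ h) x := by
  refine ContDiffAt.add ?_ (ContDiffAt.sum fun i _ => ?_)
  · exact hρ.comp x ((ContinuousLinearMap.fst ℂ E (∀ i, F i)).restrictScalars ℝ).contDiff.contDiffAt
  · exact (hh i).smooth.contDiffAt.comp x ((coord E F i).restrictScalars ℝ).contDiff.contDiffAt

theorem hasFDerivAt_hartogsFun {ρ : E → ℝ} {h : ∀ i, F i → ℝ} (hh : ConditionII h)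
    {x : E × (∀ i, F i)} (hρ : ContDiffAt ℝ ∞ ρ x.1) :
    HasFDerivAt (hartogsFun ρ h)
      ((fderiv ℝ ρ x.1).comp ((ContinuousLinearMap.fst ℂ E (∀ i, F i)).restrictScalars ℝ)
        + ∑ i, (fderiv ℝ (h i) (x.2 i)).comp ((coord E F i).restrictScalars ℝ)) x := by
  refine HasFDerivAt.add ?_ (HasFDerivAt.fun_sum fun i _ => ?_)
  · exact (hρ.differentiableAt (by simp)).hasFDerivAt.comp x
      ((ContinuousLinearMap.fst ℂ E (∀ i, F i)).restrictScalars ℝ).hasFDerivAt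
  · exact ((hh i).smooth.contDiffAt.differentiableAt (by simp)).hasFDerivAt.comp x
      ((coord E F i).restrictScalars ℝ).hasFDerivAt

theorem exists_ne_zero_of_ne_zero {G : Type*} [NormedAddCommGroup G] [NormedSpace ℝ G]
    {T : G →L[ℝ] ℝ} (hT : T ≠ 0) : ∃ v, T v ≠ 0 := by
  by_contra hcon
  push Not at hcon
  exact hT (ContinuousLinearMap.ext hcon)

theorem fderiv_hartogsFun_ne_zero_of_snd {ρ : E → ℝ} {h : ∀ i, F i → ℝ} (hh : ConditionII h)
    {x : E × (∀ i, F i)} (hρ : ContDiffAt ℝ ∞ ρ x.1) (hx : x.2 ≠ 0) :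
    ∃ v, fderiv ℝ (hartogsFun ρ h) x (0, v) ≠ 0 := by
  classical
  obtain ⟨i, hi⟩ := Function.ne_iff.1 hx
  obtain ⟨v, hv⟩ := exists_ne_zero_of_ne_zero ((hh i).gradient_ne_zero _ hi)
  refine ⟨Pi.single i v, ?_⟩
  rw [(hasFDerivAt_hartogsFun hh hρ).fderiv]
  simp only [add_apply, ContinuousLinearMap.comp_apply, sum_apply,
    ContinuousLinearMap.coe_restrictScalars', ContinuousLinearMap.coe_fst', map_zero, coord_apply]
  rw [Finset.sum_eq_single i]
  · simpa using hv
  · intro j _ hj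
    simp [Pi.single_eq_of_ne hj]
  · simp

theorem fderiv_hartogsFun_ne_zero_of_fst {ρ : E → ℝ} {h : ∀ i, F i → ℝ} (hh : ConditionII h)
    {x : E × (∀ i, F i)} (hρ : ContDiffAt ℝ ∞ ρ x.1) (hx : fderiv ℝ ρ x.1 ≠ 0) :
    fderiv ℝ (hartogsFun ρ h) x ≠ 0 := by
  obtain ⟨v, hv⟩ := exists_ne_zero_of_ne_zero hx
  intro h0
  have := congrArg (fun T => T (v, 0)) h0
  rw [(hasFDerivAt_hartogsFun hh hρ).fderiv] at this
  simp [coord_apply] at this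
  exact hv this

theorem sum_nonneg_of_conditionII {h : ∀ i, F i → ℝ} (hh : ConditionII h) (w : ∀ i, F i) :
    0 ≤ ∑ i, h i (w i) :=
  Finset.sum_nonneg fun i _ => (hh i).nonneg _

theorem sum_eq_zero_iff_of_conditionII {h : ∀ i, F i → ℝ} (hh : ConditionII h) (w : ∀ i, F i) :
    ∑ i, h i (w i) = 0 ↔ w = 0 := by
  rw [Finset.sum_eq_zero_iff_of_nonneg fun i _ => (hh i).nonneg _]
  simp only [Finset.mem_univ, true_implies, (hh _).eq_zero_iff]
  exact funext_iff.symm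

theorem isBounded_sublevel {h : ∀ i, F i → ℝ} (hh : ConditionII h) (c : ℝ) :
    Bornology.IsBounded {w : ∀ i, F i | ∑ i, h i (w i) < c} := by
  have : ∀ i, Bornology.IsBounded {v : F i | h i v ≤ c} := by
    intro i
    have := (hh i).tendsto_atTop.eventually (eventually_gt_atTop c)
    rw [Bornology.isBounded_def]
    filter_upwards [this] with v hv
    exact not_le.2 hv
  refine (Bornology.IsBounded.pi this).subset fun w hw i _ => ?_
  exact (Finset.single_le_sum (f := fun i => h i (w i)) (fun i _ => (hh i).nonneg _)
    (Finset.mem_univ i)).trans (le_of_lt hw)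

theorem continuous_sum_conditionII {h : ∀ i, F i → ℝ} (hh : ConditionII h) :
    Continuous fun w : ∀ i, F i => ∑ i, h i (w i) :=
  continuous_finsetSum _ fun i _ => (hh i).smooth.continuous.comp (continuous_apply i)

theorem isPreconnected_sublevel_sum [∀ i, ProperSpace (F i)] {h : ∀ i, F i → ℝ}
    (hh : ConditionII h) (c : ℝ) :
    IsPreconnected {w : ∀ i, F i | ∑ i, h i (w i) < c} := by
  refine isPreconnected_sublevel (a := 0) (continuous_sum_conditionII hh)
    (isBounded_sublevel hh c) fun w hw h0 => ?_
  -- The gradient of `∑ h_i` is read off from that of `hartogsFun`, with the zero function on `ℂ` in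
  -- place of `ρ`.
  have hc : ContDiffAt ℝ ∞ (fun _ : ℂ => (0 : ℝ)) 0 := contDiffAt_const
  have hd := (contDiffAt_hartogsFun hh (x := ((0 : ℂ), w)) hc).differentiableAt (by simp)
  obtain ⟨v, hv⟩ := fderiv_hartogsFun_ne_zero_of_snd hh (x := ((0 : ℂ), w)) hc hw
  apply hv
  have hi : HasFDerivAt (fun w : ∀ i, F i => ((0 : ℂ), w))
      ((ContinuousLinearMap.inr ℂ ℂ (∀ i, F i)).restrictScalars ℝ) w :=
    ((ContinuousLinearMap.inr ℂ ℂ (∀ i, F i)).restrictScalars ℝ).hasFDerivAt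
  have := (hd.hasFDerivAt.comp w hi).fderiv
  have e : hartogsFun (fun _ : ℂ => (0 : ℝ)) h ∘ (fun w : ∀ i, F i => ((0 : ℂ), w))
    = fun w => ∑ i, h i (w i) := by ext w; simp [hartogsFun]
  rw [e, h0] at this
  exact (congrArg (fun T => T v) this).symm

variable {Ω U : Set E} {ρ : E → ℝ} {h : ∀ i, F i → ℝ}

theorem IsDefiningFunctionOn.contDiffAt (hρ : IsDefiningFunctionOn Ω ρ U) {z : E}
    (hz : z ∈ closure Ω) : ContDiffAt ℝ ∞ ρ z :=
  hρ.smooth.contDiffAt (hρ.isOpen.mem_nhds (hρ.closure_subset hz))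

theorem mem_hartogsDomain_iff (hρ : IsDefiningFunctionOn Ω ρ U) (hh : ConditionII h)
    {x : E × (∀ i, F i)} (hx : x.1 ∈ U) : x ∈ hartogsDomain Ω ρ h ↔ hartogsFun ρ h x < 0 := by
  refine ⟨fun h => h.2, fun h' => ⟨(hρ.mem_iff _ hx).2 ?_, h'⟩⟩
  have := sum_nonneg_of_conditionII hh x.2
  unfold hartogsFun at h'
  linarith

theorem isOpen_hartogsDomain (hΩ : IsOpen Ω) (hρ : IsDefiningFunctionOn Ω ρ U)
    (hh : ConditionII h) : IsOpen (hartogsDomain Ω ρ h) := by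
  refine isOpen_iff_mem_nhds.2 fun x hx => ?_
  have hc := (contDiffAt_hartogsFun hh (hρ.contDiffAt (subset_closure hx.1))).continuousAt
  filter_upwards [hc.eventually (gt_mem_nhds hx.2),
    continuousAt_fst.eventually (hΩ.eventually_mem hx.1)] with y h1 h2
  exact ⟨h2, h1⟩

theorem fst_mem_closure_of_mem_frontier {x : E × (∀ i, F i)}
    (hx : x ∈ frontier (hartogsDomain Ω ρ h)) : x.1 ∈ closure Ω := by
  have := image_closure_subset_closure_image continuous_fst ⟨x, hx.1, rfl⟩
  refine closure_mono ?_ this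
  rintro _ ⟨y, hy, rfl⟩
  exact hy.1

theorem hartogsFun_eq_zero (hΩ : IsOpen Ω) (hρ : IsDefiningFunctionOn Ω ρ U)
    (hh : ConditionII h) {x : E × (∀ i, F i)} (hx : x ∈ frontier (hartogsDomain Ω ρ h)) :
    hartogsFun ρ h x = 0 := by
  have hx1 := fst_mem_closure_of_mem_frontier hx
  have hc := (contDiffAt_hartogsFun hh (hρ.contDiffAt hx1)).continuousAt
  refine le_antisymm ?_ (not_lt.1 fun hlt => hx.2 ?_)
  · by_contra hpos
    obtain ⟨y, hy, hy'⟩ := ((mem_closure_iff_frequently.1 hx.1).and_eventually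
      (hc.eventually (lt_mem_nhds (not_le.1 hpos)))).exists
    exact absurd hy.2 (not_lt.2 (le_of_lt hy'))
  · rw [(isOpen_hartogsDomain hΩ hρ hh).interior_eq]
    exact (mem_hartogsDomain_iff hρ hh (hρ.closure_subset hx1)).2 hlt

theorem fst_mem_frontier (hΩ : IsOpen Ω) (hρ : IsDefiningFunctionOn Ω ρ U)
    (hh : ConditionII h) {x : E × (∀ i, F i)} (hx : x ∈ frontier (hartogsDomain Ω ρ h))
    (hx2 : x.2 = 0) : x.1 ∈ frontier Ω := by
  have hx1 := fst_mem_closure_of_mem_frontier hx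
  have h0 := hartogsFun_eq_zero hΩ hρ hh hx
  unfold hartogsFun at h0
  rw [(sum_eq_zero_iff_of_conditionII hh x.2).2 hx2, add_zero] at h0
  refine ⟨hx1, fun hi => ?_⟩
  have := (hρ.mem_iff _ (hρ.closure_subset hx1)).1 (interior_subset hi)
  linarith

theorem isLocalDefiningFunction_hartogsFun (hΩ : IsOpen Ω) (hρ : IsDefiningFunctionOn Ω ρ U)
    (hh : ConditionII h) {x : E × (∀ i, F i)} (hx : x ∈ frontier (hartogsDomain Ω ρ h)) :
    IsLocalDefiningFunction (hartogsDomain Ω ρ h) x (hartogsFun ρ h) := by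
  have hx1 := fst_mem_closure_of_mem_frontier hx
  refine ⟨hartogsFun_eq_zero hΩ hρ hh hx, ?_, Prod.fst ⁻¹' U, hρ.isOpen.preimage continuous_fst,
    hρ.closure_subset hx1, fun y hy => ?_, fun y hy => mem_hartogsDomain_iff hρ hh hy⟩
  · by_cases hx2 : x.2 = 0
    · exact fderiv_hartogsFun_ne_zero_of_fst hh (hρ.contDiffAt hx1)
        (hρ.gradient_ne_zero _ (fst_mem_frontier hΩ hρ hh hx hx2))
    · obtain ⟨v, hv⟩ := fderiv_hartogsFun_ne_zero_of_snd hh (hρ.contDiffAt hx1) hx2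
      intro h0
      exact hv (by rw [h0]; rfl)
  · exact (contDiffAt_hartogsFun hh
      (hρ.smooth.contDiffAt (hρ.isOpen.mem_nhds hy))).contDiffWithinAt

theorem isSmoothBoundedDomain_hartogsDomain [ProperSpace E] [∀ i, ProperSpace (F i)]
    (hΩ : IsSmoothBoundedDomain Ω) (hρ : IsDefiningFunctionOn Ω ρ U) (hh : ConditionII h) :
    IsSmoothBoundedDomain (hartogsDomain Ω ρ h) := by
  have hneg : ∀ z ∈ Ω, ρ z < 0 := fun z hz =>
    (hρ.mem_iff z (hρ.closure_subset (subset_closure hz))).1 hz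
  have hzero : ∀ z ∈ Ω, (z, (0 : ∀ i, F i)) ∈ hartogsDomain Ω ρ h := fun z hz => by
    refine ⟨hz, ?_⟩
    have := (sum_eq_zero_iff_of_conditionII hh 0).2 rfl
    simp only [this, add_zero, hneg z hz]
  refine ⟨isOpen_hartogsDomain hΩ.isOpen hρ hh, ⟨?_, ?_⟩, ?_, fun x hx =>
    ⟨_, isLocalDefiningFunction_hartogsFun hΩ.isOpen hρ hh hx⟩⟩
  · obtain ⟨z, hz⟩ := hΩ.isConnected.nonempty
    exact ⟨_, hzero z hz⟩
  · obtain ⟨z₀, hz₀⟩ := hΩ.isConnected.nonempty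
    have hbase : IsPreconnected ((fun z => (z, (0 : ∀ i, F i))) '' Ω) :=
      hΩ.isConnected.isPreconnected.image _ (by fun_prop)
    -- The connecting set is `Ω × {0}` together with the fibre over `x.1`; they meet at `(x.1, 0)`.
    refine isPreconnected_of_forall (z₀, 0) fun x hx => ?_
    have hfib : IsPreconnected ((fun w => (x.1, w)) '' {w : ∀ i, F i | ∑ i, h i (w i) < -ρ x.1}) :=
      (isPreconnected_sublevel_sum hh _).image _ (by fun_prop)
    have h0' : (x.1, (0 : ∀ i, F i)) ∈ (fun z => (z, (0 : ∀ i, F i))) '' Ω := ⟨x.1, hx.1, rfl⟩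
    have h0 : (x.1, (0 : ∀ i, F i)) ∈
        (fun w => (x.1, w)) '' {w : ∀ i, F i | ∑ i, h i (w i) < -ρ x.1} := by
      refine ⟨0, ?_, rfl⟩
      have := (hzero x.1 hx.1).2
      simp only [Set.mem_ofPred_eq] at this ⊢
      linarith
    refine ⟨_, ?_, Or.inl ⟨z₀, hz₀, rfl⟩, Or.inr ⟨x.2, ?_, rfl⟩,
      hbase.union (x.1, 0) h0' h0 hfib⟩
    · rintro _ (⟨z, hz, rfl⟩ | ⟨w, hw, rfl⟩)
      · exact hzero z hz
      · refine ⟨hx.1, ?_⟩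
        have : ∑ i, h i (w i) < -ρ x.1 := hw
        simp only
        linarith
    · have := hx.2
      simp only [Set.mem_ofPred_eq]
      linarith
  · have hK : IsCompact (closure Ω) := hΩ.isBounded.isCompact_closure
    obtain ⟨M, hM⟩ := hK.bddBelow_image (f := ρ) fun z hz =>
      (hρ.contDiffAt hz).continuousAt.continuousWithinAt
    refine (hΩ.isBounded.prod (isBounded_sublevel hh (-M))).subset fun x hx => ⟨hx.1, ?_⟩
    have h1 := hM ⟨x.1, subset_closure hx.1, rfl⟩
    have h2 := hx.2
    simp only [Set.mem_ofPred_eq]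
    linarith

end Geometry

/-! ### Plurisubharmonicity of the defining function and pseudo-convexity -/

section Psh

variable {E : Type*} [NormedAddCommGroup E] [NormedSpace ℂ E]

theorem leviForm_comp_nonneg [CompleteSpace E] {U : Set E} (hU : IsOpen U) {k : E → ℝ}
    (hk : ContDiffOn ℝ ∞ k U) (hp : IsPshOn k U) {φ : ℂ → E} {ζ : ℂ} (hφ : AnalyticAt ℂ φ ζ)
    (hζ : φ ζ ∈ U) (t : ℂ) : 0 ≤ leviForm (fun ξ => k (φ ξ)) ζ t := by
  rw [leviForm_comp (contDiffAt_two (hk.contDiffAt (hU.mem_nhds hζ))) hφ]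
  exact hp _ hζ _

variable {ι : Type*} [Fintype ι] {F : ι → Type*} [∀ i, NormedAddCommGroup (F i)]
  [∀ i, NormedSpace ℂ (F i)] {Ω U : Set E} {ρ : E → ℝ} {h : ∀ i, F i → ℝ}

theorem isPshOn_hartogsFun [CompleteSpace E] [∀ i, CompleteSpace (F i)]
    (hρ : IsDefiningFunctionOn Ω ρ U) (hp : IsPshOn ρ U) (hh : ConditionII h) :
    IsPshOn (hartogsFun ρ h) (Prod.fst ⁻¹' U) := by
  intro x hx t
  -- On a complex line the Levi form becomes a one-variable one, where each summand is a
  -- plurisubharmonic function composed with a holomorphic map.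
  let φ : ℂ → E × (∀ i, F i) := fun ζ => x + ζ • t
  have hφ : AnalyticAt ℂ φ 0 := analyticAt_const.add (analyticAt_id.smul analyticAt_const)
  have hφ0 : φ 0 = x := by simp [φ]
  have hd : deriv φ 0 = t := by
    have : HasDerivAt φ ((1 : ℂ) • t) 0 := ((hasDerivAt_id (0 : ℂ)).smul_const t).const_add x
    rw [this.deriv, one_smul]
  have hρx : ContDiffAt ℝ ∞ ρ x.1 := hρ.smooth.contDiffAt (hρ.isOpen.mem_nhds hx)
  have hr := contDiffAt_hartogsFun hh hρx
  have key := leviForm_comp (f := hartogsFun ρ h) (φ := φ) (ζ := 0)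
    (by rw [hφ0]; exact contDiffAt_two hr) hφ 1
  rw [hφ0, hd, one_smul] at key
  have hφ1 : AnalyticAt ℂ (fun ζ => (φ ζ).1) 0 := (analyticAt_fst).comp hφ
  have hφi : ∀ i, AnalyticAt ℂ (fun ζ => (φ ζ).2 i) 0 := fun i =>
    ((coord E F i).analyticAt _).comp hφ
  have hf : ContDiffAt ℝ ∞ (fun ζ => ρ (φ ζ).1) 0 :=
    ContDiffAt.comp (0 : ℂ) (by rw [hφ0]; exact hρx) (hφ1.contDiffAt.restrict_scalars ℝ)
  have hfi : ∀ i, ContDiffAt ℝ ∞ (fun ζ => h i ((φ ζ).2 i)) 0 := fun i =>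
    (hh i).smooth.contDiffAt.comp (0 : ℂ) ((hφi i).contDiffAt.restrict_scalars ℝ)
  rw [← key]
  refine le_of_le_of_eq ?_ (leviForm_add (f := fun ζ => ρ (φ ζ).1)
    (g := fun ζ => ∑ i, h i ((φ ζ).2 i)) (contDiffAt_two hf)
    (ContDiffAt.sum fun i _ => contDiffAt_two (hfi i)) 1).symm
  rw [leviForm_sum _ fun i _ => contDiffAt_two (hfi i)]
  refine add_nonneg (leviForm_comp_nonneg hρ.isOpen hρ.smooth hp hφ1 (by rw [hφ0]; exact hx) 1)
    (Finset.sum_nonneg fun i _ => ?_)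
  exact leviForm_comp_nonneg isOpen_univ (hh i).smooth.contDiffOn (hh i).psh (hφi i)
    (Set.mem_univ _) 1

theorem isPseudoconvex_hartogsDomain [CompleteSpace E] [∀ i, CompleteSpace (F i)]
    (hΩ : IsOpen Ω) (hρ : IsDefiningFunctionOn Ω ρ U) (hp : IsPshOn ρ U) (hh : ConditionII h) :
    IsPseudoconvex (hartogsDomain Ω ρ h) := fun x hx =>
  ⟨_, isLocalDefiningFunction_hartogsFun hΩ hρ hh hx, fun t _ _ =>
    isPshOn_hartogsFun hρ hp hh x (hρ.closure_subset (fst_mem_closure_of_mem_frontier hx)) t⟩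

end Psh

/-! ### Orders of sums -/

section Sums

variable {D : Type} [NormedAddCommGroup D] [NormedSpace ℝ D]

theorem le_order_sum {ι G : Type*} [NormedAddCommGroup G] [NormedSpace ℝ G] {s : Finset ι}
    {f : ι → D → G} (hf : ∀ i ∈ s, ContDiffAt ℝ ∞ (f i) 0) {n : ℕ}
    (h : ∀ i ∈ s, (n : ℕ∞) ≤ order (f i) 0) :
    (n : ℕ∞) ≤ order (fun x => ∑ i ∈ s, f i x) 0 :=
  (le_order_iff_isBigO (ContDiffAt.sum hf)).2
    (IsBigO.fun_sum fun i hi => (le_order_iff_isBigO (hf i hi)).1 (h i hi))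

theorem one_le_order {G : Type*} [NormedAddCommGroup G] [NormedSpace ℝ G] {f : D → G} {x : D}
    (h : f x = 0) : 1 ≤ order f x := by
  have := (le_order_succ_iff_fderiv (f := f) (x := x) (n := 0)).2 ⟨h, by simp⟩
  simpa using this

theorem order_eq_top_of_eventuallyEq_zero {G : Type*} [NormedAddCommGroup G] [NormedSpace ℝ G]
    {f : D → G} {x : D} (h : f =ᶠ[𝓝 x] 0) : order f x = ⊤ := by
  rw [order_congr h]
  simp [order]

/-- If the order of `f + ∑ c i` is at most twice that of each `c i`, then it is at most twice that
of `f`. -/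
theorem order_add_sum_le {ι : Type*} {s : Finset ι} {f : D → ℝ} {c : ι → D → ℝ}
    (hf : ContDiffAt ℝ ∞ f 0) (hc : ∀ i ∈ s, ContDiffAt ℝ ∞ (c i) 0)
    (h : ∀ i ∈ s, order (fun x => f x + ∑ i ∈ s, c i x) 0 ≤ 2 * order (c i) 0) :
    order (fun x => f x + ∑ i ∈ s, c i x) 0 ≤ 2 * order f 0 := by
  by_contra hlt
  push Not at hlt
  have hne : order f 0 ≠ ⊤ := by
    intro h'
    rw [h'] at hlt
    simp at hlt
  obtain ⟨n, hn⟩ := ENat.ne_top_iff_exists.1 hne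
  rw [← hn] at hlt
  have hsum : ContDiffAt ℝ ∞ (fun x => ∑ i ∈ s, c i x) 0 := ContDiffAt.sum hc
  -- If `f` has order `n` and the total has order above `2n`, then each `c i` and the total have
  -- order above `n`; hence so does their difference `f`, a contradiction.
  have h1 : ∀ i ∈ s, ((n + 1 : ℕ) : ℕ∞) ≤ order (c i) 0 := by
    intro i hi
    by_contra hle
    push Not at hle
    have hle' : order (c i) 0 ≤ n := by
      push_cast at hle
      exact Order.le_of_lt_add_one hle
    exact absurd ((h i hi).trans (mul_le_mul_right hle' 2)) (not_le.2 hlt)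
  have h2 : ((n + 1 : ℕ) : ℕ∞) ≤ order (fun x => f x + ∑ i ∈ s, c i x) 0 := by
    have h3 : (n : ℕ∞) ≤ 2 * n := by exact_mod_cast (by omega : n ≤ 2 * n)
    have := Order.add_one_le_of_lt (h3.trans_lt hlt)
    exact_mod_cast this
  have h3 := order_sub_le (hf.add hsum) hsum h2 (le_order_sum hc h1)
  have e : ((fun x => f x + ∑ i ∈ s, c i x) - fun x => ∑ i ∈ s, c i x) = f := by
    ext x; simp
  rw [e, ← hn] at h3
  have : n + 1 ≤ n := by exact_mod_cast h3
  omega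

end Sums

/-! ### Discs as competitors for the type, and lower bounds for Levi forms -/

section Disc

variable {E : Type*} [NormedAddCommGroup E] [NormedSpace ℂ E]

/-- A holomorphic map whose order at the centre is finite is a disc, hence a competitor in the
definition of the type. -/
theorem order_le_typ_mul_order {k : E → ℝ} {φ : ℂ → E} {z : E}
    (hφ : DifferentiableOn ℂ φ (Metric.ball 0 1)) (hz : φ 0 = z)
    (hne : order (fun ζ => φ ζ - z) 0 ≠ ⊤) :
    ((order (fun ζ => k (φ ζ) - k z) 0 : ℕ∞) : ENNReal)
      ≤ typ k z * ((order (fun ζ => φ ζ - z) 0 : ℕ∞) : ENNReal) := by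
  have hd : IsDiscAt φ z := by
    refine ⟨hφ, hz, ?_⟩
    by_contra hcon
    push Not at hcon
    refine hne (order_eq_top_of_eventuallyEq_zero ?_)
    filter_upwards [Metric.ball_mem_nhds (0 : ℂ) one_pos] with ζ hζ
    simp [hcon ζ hζ]
  have h1 : 1 ≤ order (fun ζ => φ ζ - z) 0 := one_le_order (by simp [hz])
  rw [← ENNReal.div_le_iff]
  · exact le_iSup₂_of_le (f := fun (φ : ℂ → E) (_ : IsDiscAt φ z) =>
      ((order (fun ζ => k (φ ζ) - k z) 0 : ℕ∞) : ENNReal) /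
        ((order (fun ζ => φ ζ - z) 0 : ℕ∞) : ENNReal)) φ hd le_rfl
  · have : (order (fun ζ => φ ζ - z) 0) ≠ 0 := (lt_of_lt_of_le zero_lt_one h1).ne'
    simpa using this
  · simpa using hne

/-- A complex line through `z` has order exactly 1. This lets `2 typ ρ` absorb the constant 2 of the
components with `w_i ≠ 0`. -/
theorem one_le_typ [Nontrivial E] (k : E → ℝ) (z : E) : 1 ≤ typ k z := by
  obtain ⟨e, he⟩ := exists_ne (0 : E)
  let φ : ℂ → E := fun ζ => z + ζ • e
  have hφ : Differentiable ℂ φ := by fun_prop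
  have hz : φ 0 = z := by simp [φ]
  have hle : order (fun ζ => φ ζ - z) 0 ≤ 1 := by
    by_contra hlt
    push Not at hlt
    have h2 : ((1 + 1 : ℕ) : ℕ∞) ≤ order (fun ζ => φ ζ - z) 0 := by
      have := Order.add_one_le_of_lt hlt
      exact_mod_cast this
    have h3 := (le_order_succ_iff_fderiv (n := 0)).1 (le_order_succ_iff_fderiv.1 h2).2
    have h4 : HasFDerivAt (fun ζ => φ ζ - z)
        ((ContinuousLinearMap.toSpanSingleton ℂ e).restrictScalars ℝ) 0 := by
      have : (fun ζ => φ ζ - z) = (ContinuousLinearMap.toSpanSingleton ℂ e).restrictScalars ℝ := by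
        ext ζ; simp [φ]
      rw [this]
      exact ContinuousLinearMap.hasFDerivAt _
    have h5 := congrArg (fun T => T 1) (h4.fderiv.symm.trans h3.1)
    exact he (by simpa using h5)
  have h1 := order_le_typ_mul_order (k := k) hφ.differentiableOn hz
    (ne_top_of_le_ne_top (by simp) hle)
  have heq : order (fun ζ => φ ζ - z) 0 = 1 := le_antisymm hle (one_le_order (by simp [hz]))
  rw [heq] at h1
  have h2 : 1 ≤ order (fun ζ => k (φ ζ) - k z) 0 := one_le_order (by simp [hz])
  have h3 := ENat.toENNReal_le.2 h2
  simp only [ENat.toENNReal_one, mul_one] at h1 h3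
  exact h3.trans h1

theorem norm_fderiv_le_norm_deriv {φ : ℂ → E} {ζ : ℂ} (hφ : DifferentiableAt ℂ φ ζ) (z : E) :
    ‖fderiv ℝ (fun ξ => φ ξ - z) ζ‖ ≤ ‖deriv φ ζ‖ := by
  have h : HasFDerivAt φ
      ((ContinuousLinearMap.toSpanSingleton ℂ (deriv φ ζ)).restrictScalars ℝ) ζ :=
    hφ.hasDerivAt.hasFDerivAt.restrictScalars ℝ
  rw [(h.sub_const z).fderiv]
  refine ContinuousLinearMap.opNorm_le_bound _ (norm_nonneg _) fun v => ?_
  simp [norm_smul, mul_comm]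

theorem leviForm_smul {f : E → ℝ} (z t : E) (r : ℝ) :
    leviForm f z (r • t) = r ^ 2 * leviForm f z t := by
  have : Complex.I • r • t = r • Complex.I • t := smul_comm _ _ _
  simp only [leviForm, this, map_smul, smul_apply, smul_eq_mul]
  ring

/-- A strictly positive Levi form is locally uniformly bounded below. -/
theorem exists_leviForm_lower_bound [ProperSpace E] {f : E → ℝ} (hf : ContDiff ℝ ∞ f) {w : E}
    (hw : ∀ t, t ≠ 0 → 0 < leviForm f w t) :
    ∃ C : ℝ, ∀ᶠ y in 𝓝 w, ∀ t, ‖t‖ ^ 2 ≤ C * leviForm f y t := by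
  have hcont : Continuous fun p : E × E => leviForm f p.1 p.2 := by
    have h1 : ContDiff ℝ ∞ (fderiv ℝ f) := hf.fderiv_right (by simp)
    have h2 : Continuous (fderiv ℝ (fderiv ℝ f)) := h1.continuous_fderiv (by simp)
    unfold leviForm
    fun_prop
  obtain ⟨c, hc, hcw⟩ : ∃ c > 0, ∀ t ∈ Metric.sphere (0 : E) 1, c < leviForm f w t := by
    -- The sphere is empty when `E` is trivial, which `m_i = 0` permits. Otherwise half the minimum
    -- leaves room to perturb the base point.
    rcases (Metric.sphere (0 : E) 1).eq_empty_or_nonempty with he | hne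
    · exact ⟨1, one_pos, by simp [he]⟩
    · obtain ⟨t₀, ht₀, hmin⟩ := (isCompact_sphere (0 : E) 1).exists_isMinOn hne
        (hcont.comp (Continuous.prodMk_right w)).continuousOn
      have hpos := hw t₀ (by rintro rfl; simp at ht₀)
      refine ⟨leviForm f w t₀ / 2, by positivity, fun t ht => ?_⟩
      have : leviForm f w t₀ ≤ leviForm f w t := hmin ht
      linarith
  have hev : ∀ᶠ y in 𝓝 w, ∀ t ∈ Metric.sphere (0 : E) 1, c < leviForm f y t :=
    (isCompact_sphere (0 : E) 1).eventually_forall_of_forall_eventually fun t ht =>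
      hcont.continuousAt.eventually (lt_mem_nhds (hcw t ht))
  refine ⟨c⁻¹, hev.mono fun y hy t => ?_⟩
  by_cases ht : t = 0
  · simp [ht, leviForm]
  have hn : 0 < ‖t‖ := norm_pos_iff.2 ht
  have h1 := hy (‖t‖⁻¹ • t) (by simp [norm_smul, hn.ne'])
  rw [leviForm_smul, inv_pow, inv_mul_eq_div, lt_div_iff₀ (by positivity)] at h1
  rw [inv_mul_eq_div, le_div_iff₀ hc]
  linarith

variable {ι : Type*} [Fintype ι] {F : ι → Type*} [∀ i, NormedAddCommGroup (F i)]
  [∀ i, NormedSpace ℂ (F i)]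

/-- The order of a disc in a product is attained by one of its components. -/
theorem exists_order_component_le {φ : ℂ → E × (∀ i, F i)} {x : E × (∀ i, F i)}
    (hφ : ContDiffAt ℝ ∞ φ 0) (hne : order (fun ζ => φ ζ - x) 0 ≠ ⊤) :
    order (fun ζ => (φ ζ).1 - x.1) 0 ≤ order (fun ζ => φ ζ - x) 0 ∨
      ∃ i, order (fun ζ => (φ ζ).2 i - x.2 i) 0 ≤ order (fun ζ => φ ζ - x) 0 := by
  obtain ⟨n, hn⟩ := ENat.ne_top_iff_exists.1 hne
  by_contra! hcon
  rw [← hn] at hcon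
  obtain ⟨h1, h2⟩ := hcon
  have hsucc : ∀ {a : ℕ∞}, (n : ℕ∞) < a → ((n + 1 : ℕ) : ℕ∞) ≤ a := fun h => by
    exact_mod_cast Order.add_one_le_of_lt h
  have hφs : ContDiffAt ℝ ∞ (fun ζ => φ ζ - x) 0 := hφ.sub contDiffAt_const
  have hO1 : ContDiffAt ℝ ∞ (fun ζ => (φ ζ).1 - x.1) 0 :=
    ((ContinuousLinearMap.fst ℂ E (∀ i, F i)).restrictScalars ℝ).contDiff.contDiffAt.comp (0 : ℂ) hφs
  have hO2 : ∀ i, ContDiffAt ℝ ∞ (fun ζ => (φ ζ).2 i - x.2 i) 0 := fun i =>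
    ((coord E F i).restrictScalars ℝ).contDiff.contDiffAt.comp (0 : ℂ) hφs
  have b1 := (le_order_iff_isBigO hO1).1 (hsucc h1)
  have b2 := fun i => (le_order_iff_isBigO (hO2 i)).1 (hsucc (h2 i))
  have h3 : ((n + 1 : ℕ) : ℕ∞) ≤ order (fun ζ => φ ζ - x) 0 :=
    (le_order_iff_isBigO hφs).2 (b1.prod_left (isBigO_pi.2 b2))
  rw [← hn] at h3
  have : n + 1 ≤ n := by exact_mod_cast h3
  omega

end Disc

/-! ### Gradient bound from plurisubharmonicity of the logarithm -/

section LogPsh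

variable {E : Type*} [NormedAddCommGroup E] [NormedSpace ℂ E]

theorem ConditionIIAt.exists_sq_fderiv_le [CompleteSpace E] {h : E → ℝ} (hh : ConditionIIAt h)
    {φ : ℂ → E} (hφ : AnalyticAt ℂ φ 0) (h0 : φ 0 ≠ 0) (c : ℝ) :
    ∃ C ≥ 0, ∀ᶠ ζ in 𝓝 0, ‖fderiv ℝ (fun ξ => h (φ ξ) - c) ζ‖ ^ 2
      ≤ C * leviForm (fun ξ => h (φ ξ)) ζ 1 := by
  have hpos : ∀ w, w ≠ 0 → 0 < h w := fun w hw =>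
    lt_of_le_of_ne (hh.nonneg w) fun h' => hw ((hh.eq_zero_iff w).1 h'.symm)
  set M := h (φ 0) + 1
  have hM : 0 ≤ M := by have := hh.nonneg (φ 0); positivity
  have hcont : ContinuousAt (fun ξ => h (φ ξ)) 0 :=
    hh.smooth.continuous.continuousAt.comp hφ.continuousAt
  -- `M` bounds `h ∘ φ` near 0; the inequality for logarithms gives a factor 4, and the norm bound
  -- `‖T‖ ≤ |T 1| + |T I|`, once squared, a factor 2.
  refine ⟨8 * M, by positivity, ?_⟩
  filter_upwards [hφ.eventually_analyticAt, hφ.continuousAt.eventually_ne h0,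
    hcont.eventually (gt_mem_nhds (lt_add_one (h (φ 0))))] with ζ ha hne hlt
  have hu : ContDiffAt ℝ 2 (fun ξ => h (φ ξ)) ζ :=
    (contDiffAt_two hh.smooth.contDiffAt).comp ζ (ha.contDiffAt.restrict_scalars ℝ)
  have hlog : 0 ≤ leviForm (fun ξ => Real.log (h (φ ξ))) ζ 1 := by
    rw [leviForm_comp (f := fun w => Real.log (h w))
      ((contDiffAt_two hh.smooth.contDiffAt).log (hpos _ hne).ne') ha]
    exact hh.log_psh _ hne _
  have hlevi : 0 ≤ leviForm (fun ξ => h (φ ξ)) ζ 1 :=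
    leviForm_comp_nonneg isOpen_univ hh.smooth.contDiffOn hh.psh ha (Set.mem_univ _) 1
  have key := sq_fderiv_le_of_log_psh hu (hpos _ hne) hlog
  rw [fderiv_sub_const]
  set T := fderiv ℝ (fun ξ => h (φ ξ)) ζ
  have hT : ‖T‖ ≤ |T 1| + |T Complex.I| := by
    refine ContinuousLinearMap.opNorm_le_bound _ (by positivity) fun v => ?_
    have e : v = v.re • (1 : ℂ) + v.im • Complex.I := by
      apply Complex.ext <;> simp
    have e' : T v = v.re * T 1 + v.im * T Complex.I := by
      have := congrArg T e
      rwa [map_add, map_smul, map_smul, smul_eq_mul, smul_eq_mul] at this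
    rw [e', Real.norm_eq_abs]
    calc |v.re * T 1 + v.im * T Complex.I| ≤ |v.re| * |T 1| + |v.im| * |T Complex.I| := by
          rw [← abs_mul, ← abs_mul]; exact abs_add_le _ _
      _ ≤ ‖v‖ * |T 1| + ‖v‖ * |T Complex.I| := by
          gcongr
          exacts [Complex.abs_re_le_norm v, Complex.abs_im_le_norm v]
      _ = _ := by ring
  rw [smul_eq_mul, mul_one] at key
  have h1 : ‖T‖ ^ 2 ≤ (|T 1| + |T Complex.I|) ^ 2 := by gcongr
  have h2 : (|T 1| + |T Complex.I|) ^ 2 ≤ 2 * (T 1 ^ 2 + T Complex.I ^ 2) := by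
    have := sq_nonneg (|T 1| - |T Complex.I|)
    rw [← sq_abs (T 1), ← sq_abs (T Complex.I)]
    linarith
  have h3 : 4 * h (φ ζ) * leviForm (fun ξ => h (φ ξ)) ζ 1
      ≤ 4 * M * leviForm (fun ξ => h (φ ξ)) ζ 1 := by gcongr
  linarith

end LogPsh

/-! ### Bounds on the type of the boundary -/

section Estimate

variable {E : Type*} [NormedAddCommGroup E] [NormedSpace ℂ E] [ProperSpace E]
  {ι : Type*} [Fintype ι] {F : ι → Type*} [∀ i, NormedAddCommGroup (F i)]
  [∀ i, NormedSpace ℂ (F i)] [∀ i, ProperSpace (F i)]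
  {Ω U : Set E} {ρ : E → ℝ} {h : ∀ i, F i → ℝ} {x : E × (∀ i, F i)}
  {φ : ℂ → E × (∀ i, F i)}

open Classical in
/-- The restriction to a disc of the part of the defining function that involves only `z` and the
`w_i` with `w_i ≠ 0` at the centre. -/
noncomputable def nonvanishingPart (ρ : E → ℝ) (h : ∀ i, F i → ℝ) (x : E × (∀ i, F i))
    (φ : ℂ → E × (∀ i, F i)) (ζ : ℂ) : ℝ :=
  (ρ (φ ζ).1 - ρ x.1) + ∑ i with x.2 i ≠ 0, (h i ((φ ζ).2 i) - h i (x.2 i))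

theorem IsDiscAt.analyticAt_fst (hφ : IsDiscAt φ x) : AnalyticAt ℂ (fun ζ => (φ ζ).1) 0 :=
  _root_.analyticAt_fst.comp hφ.analyticAt

theorem IsDiscAt.analyticAt_snd (hφ : IsDiscAt φ x) (i : ι) :
    AnalyticAt ℂ (fun ζ => (φ ζ).2 i) 0 :=
  ((coord E F i).analyticAt _).comp hφ.analyticAt

theorem IsDiscAt.contDiffAt_fst_part (hφ : IsDiscAt φ x) (hρ : ContDiffAt ℝ ∞ ρ x.1) :
    ContDiffAt ℝ ∞ (fun ζ => ρ (φ ζ).1 - ρ x.1) 0 :=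
  (ContDiffAt.comp (0 : ℂ) (by rw [hφ.center]; exact hρ)
    (hφ.analyticAt_fst.contDiffAt.restrict_scalars ℝ)).sub contDiffAt_const

theorem IsDiscAt.contDiffAt_snd_part (hφ : IsDiscAt φ x) (hh : ConditionII h) (i : ι) :
    ContDiffAt ℝ ∞ (fun ζ => h i ((φ ζ).2 i) - h i (x.2 i)) 0 :=
  ((hh i).smooth.contDiffAt.comp (0 : ℂ)
    ((hφ.analyticAt_snd i).contDiffAt.restrict_scalars ℝ)).sub contDiffAt_const

theorem IsDiscAt.contDiffAt_nonvanishingPart (hφ : IsDiscAt φ x) (hρ : ContDiffAt ℝ ∞ ρ x.1)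
    (hh : ConditionII h) : ContDiffAt ℝ ∞ (nonvanishingPart ρ h x φ) 0 :=
  (hφ.contDiffAt_fst_part hρ).add (ContDiffAt.sum fun i _ => hφ.contDiffAt_snd_part hh i)

open Classical in
theorem IsDiscAt.eventually_leviForm_nonvanishingPart (hφ : IsDiscAt φ x)
    (hρ : IsDefiningFunctionOn Ω ρ U) (hp : IsPshOn ρ U) (hh : ConditionII h) (hx : x.1 ∈ U) :
    ∀ᶠ ζ in 𝓝 0, ∀ t, 0 ≤ leviForm (nonvanishingPart ρ h x φ) ζ t ∧
      ∀ i, x.2 i ≠ 0 → leviForm (fun ζ => h i ((φ ζ).2 i)) ζ t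
        ≤ leviForm (nonvanishingPart ρ h x φ) ζ t := by
  have hmem : ∀ᶠ ζ in 𝓝 (0 : ℂ), (φ ζ).1 ∈ U :=
    hφ.analyticAt_fst.continuousAt.eventually
      (hρ.isOpen.eventually_mem (show (φ 0).1 ∈ U by rw [hφ.center]; exact hx))
  filter_upwards [hφ.analyticAt_fst.eventually_analyticAt,
    eventually_all.2 fun i => (hφ.analyticAt_snd i).eventually_analyticAt, hmem] with ζ h1 h2 h3 t
  have hz : ContDiffAt ℝ ∞ (fun ζ => ρ (φ ζ).1 - ρ x.1) ζ :=
    (ContDiffAt.comp ζ (hρ.smooth.contDiffAt (hρ.isOpen.mem_nhds h3))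
      (h1.contDiffAt.restrict_scalars ℝ)).sub contDiffAt_const
  have hw : ∀ i, ContDiffAt ℝ ∞ (fun ζ => h i ((φ ζ).2 i) - h i (x.2 i)) ζ := fun i =>
    ((hh i).smooth.contDiffAt.comp ζ ((h2 i).contDiffAt.restrict_scalars ℝ)).sub contDiffAt_const
  have e : leviForm (nonvanishingPart ρ h x φ) ζ t = leviForm (fun ζ => ρ (φ ζ).1) ζ t
      + ∑ i with x.2 i ≠ 0, leviForm (fun ζ => h i ((φ ζ).2 i)) ζ t := by
    refine (leviForm_add (f := fun ζ => ρ (φ ζ).1 - ρ x.1) (contDiffAt_two hz)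
      (ContDiffAt.sum fun i _ => contDiffAt_two (hw i)) t).trans ?_
    rw [leviForm_sum _ fun i _ => contDiffAt_two (hw i), leviForm_sub_const]
    simp only [leviForm_sub_const]
  have hn1 : 0 ≤ leviForm (fun ζ => ρ (φ ζ).1) ζ t :=
    leviForm_comp_nonneg hρ.isOpen hρ.smooth hp h1 h3 t
  have hn2 : ∀ i, 0 ≤ leviForm (fun ζ => h i ((φ ζ).2 i)) ζ t := fun i =>
    leviForm_comp_nonneg isOpen_univ (hh i).smooth.contDiffOn (hh i).psh (h2 i) (Set.mem_univ _) t
  rw [e]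
  refine ⟨add_nonneg hn1 (Finset.sum_nonneg fun i _ => hn2 i), fun i hi => ?_⟩
  have := Finset.single_le_sum (f := fun i => leviForm (fun ζ => h i ((φ ζ).2 i)) ζ t)
    (s := Finset.univ.filter fun i => x.2 i ≠ 0) (fun i _ => hn2 i)
    (Finset.mem_filter.2 ⟨Finset.mem_univ i, hi⟩)
  linarith

/-- Strict plurisubharmonicity of `h i` near `x.2 i ≠ 0` bounds `|φ_i'|²` by the Levi form of `h i ∘
φ_i`, itself dominated by that of the whole. -/
theorem IsDiscAt.order_nonvanishingPart_le_snd (hφ : IsDiscAt φ x)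
    (hρ : IsDefiningFunctionOn Ω ρ U) (hp : IsPshOn ρ U) (hh : ConditionII h) (hx : x.1 ∈ U)
    {i : ι} (hi : x.2 i ≠ 0) :
    order (nonvanishingPart ρ h x φ) 0 ≤ 2 * order (fun ζ => (φ ζ).2 i - x.2 i) 0 := by
  have hρx : ContDiffAt ℝ ∞ ρ x.1 := hρ.smooth.contDiffAt (hρ.isOpen.mem_nhds hx)
  obtain ⟨C, hC⟩ := exists_leviForm_lower_bound (hh i).smooth ((hh i).strictly_psh (x.2 i) hi)
  have hc : Tendsto (fun ζ => (φ ζ).2 i) (𝓝 0) (𝓝 (x.2 i)) := by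
    have := (hφ.analyticAt_snd i).continuousAt.tendsto
    rwa [hφ.center] at this
  refine order_le_two_mul_order (C := |C|) (hφ.contDiffAt_nonvanishingPart hρx hh)
    (((hφ.analyticAt_snd i).contDiffAt.restrict_scalars ℝ).sub contDiffAt_const)
    (by simp [hφ.center]) ?_
  filter_upwards [hc.eventually hC, (hφ.analyticAt_snd i).eventually_analyticAt,
    hφ.eventually_leviForm_nonvanishingPart hρ hp hh hx] with ζ h1 h2 h3
  have h4 := h1 (deriv (fun ζ => (φ ζ).2 i) ζ)
  have h5 := (h3 1).2 i hi
  rw [leviForm_comp (contDiffAt_two (hh i).smooth.contDiffAt) h2, one_smul] at h5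
  have h6 := norm_fderiv_le_norm_deriv h2.differentiableAt (x.2 i)
  have h7 : 0 ≤ leviForm (h i) ((φ ζ).2 i) (deriv (fun ζ => (φ ζ).2 i) ζ) :=
    (hh i).psh _ (Set.mem_univ _) _
  calc _ ≤ ‖deriv (fun ζ => (φ ζ).2 i) ζ‖ ^ 2 := by gcongr
    _ ≤ C * leviForm (h i) ((φ ζ).2 i) (deriv (fun ζ => (φ ζ).2 i) ζ) := h4
    _ ≤ |C| * leviForm (h i) ((φ ζ).2 i) (deriv (fun ζ => (φ ζ).2 i) ζ) := by
        gcongr; exact le_abs_self C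
    _ ≤ _ := by gcongr

/-- The terms `h i` might cancel the leading part of the `ρ` term, but `log h i` being
plurisubharmonic makes the order of the whole at most twice that of each of them, which
`order_add_sum_le` transfers to the `ρ` term. -/
theorem IsDiscAt.order_nonvanishingPart_le_fst (hφ : IsDiscAt φ x)
    (hρ : IsDefiningFunctionOn Ω ρ U) (hp : IsPshOn ρ U) (hh : ConditionII h) (hx : x.1 ∈ U) :
    order (nonvanishingPart ρ h x φ) 0 ≤ 2 * order (fun ζ => ρ (φ ζ).1 - ρ x.1) 0 := by
  classical
  have hρx : ContDiffAt ℝ ∞ ρ x.1 := hρ.smooth.contDiffAt (hρ.isOpen.mem_nhds hx)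
  refine order_add_sum_le (c := fun i ζ => h i ((φ ζ).2 i) - h i (x.2 i))
    (hφ.contDiffAt_fst_part hρx) (fun i _ => hφ.contDiffAt_snd_part hh i) fun i hi => ?_
  have hi' : x.2 i ≠ 0 := (Finset.mem_filter.1 hi).2
  obtain ⟨C, hC0, hC⟩ := (hh i).exists_sq_fderiv_le (hφ.analyticAt_snd i)
    (by rwa [hφ.center]) (h i (x.2 i))
  refine order_le_two_mul_order (C := C) (hφ.contDiffAt_nonvanishingPart hρx hh)
    (hφ.contDiffAt_snd_part hh i) (by simp [hφ.center]) ?_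
  filter_upwards [hC, hφ.eventually_leviForm_nonvanishingPart hρ hp hh hx] with ζ h1 h2
  exact h1.trans (mul_le_mul_of_nonneg_left ((h2 1).2 i hi') hC0)

open Classical in
theorem IsDiscAt.order_hartogsFun_le (hφ : IsDiscAt φ x)
    (hρ : IsDefiningFunctionOn Ω ρ U) (hp : IsPshOn ρ U) (hh : ConditionII h) (hx : x.1 ∈ U) :
    order (fun ζ => hartogsFun ρ h (φ ζ) - hartogsFun ρ h x) 0
        ≤ order (nonvanishingPart ρ h x φ) 0 ∧
      ∀ i, x.2 i = 0 → order (fun ζ => hartogsFun ρ h (φ ζ) - hartogsFun ρ h x) 0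
        ≤ order (fun ζ => h i ((φ ζ).2 i) - h i (x.2 i)) 0 := by
  have hρx : ContDiffAt ℝ ∞ ρ x.1 := hρ.smooth.contDiffAt (hρ.isOpen.mem_nhds hx)
  set S : ℂ → ℝ := fun ζ => ∑ i with ¬ x.2 i ≠ 0, (h i ((φ ζ).2 i) - h i (x.2 i)) with hS
  have hterm : ∀ i, ¬ x.2 i ≠ 0 → ∀ ζ, 0 ≤ h i ((φ ζ).2 i) - h i (x.2 i) := by
    intro i hi ζ
    rw [((hh i).eq_zero_iff _).2 (not_not.1 hi), sub_zero]
    exact (hh i).nonneg _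
  have hSs : ContDiffAt ℝ ∞ S 0 := ContDiffAt.sum fun i _ => hφ.contDiffAt_snd_part hh i
  have hSpos : ∀ ζ, 0 ≤ S ζ := fun ζ =>
    Finset.sum_nonneg fun i hi => hterm i (Finset.mem_filter.1 hi).2 ζ
  have hS0 : S 0 = 0 := Finset.sum_eq_zero fun i _ => by rw [hφ.center, sub_self]
  have hG := hφ.contDiffAt_nonvanishingPart hρx hh
  have hGl := (hφ.eventually_leviForm_nonvanishingPart hρ hp hh hx).mono
    fun ζ hζ t => (hζ t).1
  have e : (fun ζ => hartogsFun ρ h (φ ζ) - hartogsFun ρ h x) = nonvanishingPart ρ h x φ + S := by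
    ext ζ
    simp only [hartogsFun, Pi.add_apply, nonvanishingPart, hS]
    rw [add_assoc, Finset.sum_filter_add_sum_filter_not, Finset.sum_sub_distrib]
    ring
  rw [e]
  refine ⟨order_add_le_left hG hSs hGl (Eventually.of_forall hSpos) hS0, fun i hi => ?_⟩
  refine (order_add_le_right hG hSs hGl (Eventually.of_forall hSpos) hS0).trans
    (order_le_order (hφ.contDiffAt_snd_part hh i) hSs ?_)
  refine IsBigO.of_bound 1 (Eventually.of_forall fun ζ => ?_)
  rw [one_mul, Real.norm_of_nonneg (hterm i (not_not.2 hi) ζ), Real.norm_of_nonneg (hSpos ζ)]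
  exact Finset.single_le_sum (f := fun i => h i ((φ ζ).2 i) - h i (x.2 i))
    (fun j hj => hterm j (Finset.mem_filter.1 hj).2 ζ)
    (Finset.mem_filter.2 ⟨Finset.mem_univ i, not_not.2 hi⟩)

/-- To bound the type of `ρ (z) + ∑ i, h_i (w_i)` it is enough to treat the discs whose order is
attained by a given component. -/
theorem typ_hartogsFun_le (hρ : IsDefiningFunctionOn Ω ρ U) (hp : IsPshOn ρ U)
    (hh : ConditionII h) (hx : x.1 ∈ U) {T : ENNReal}
    (hA : ∀ i, x.2 i = 0 → typ (h i) 0 ≤ T)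
    (hfst : ∀ φ, IsDiscAt φ x → order (fun ζ => (φ ζ).1 - x.1) 0 ≠ ⊤ →
      ((order (nonvanishingPart ρ h x φ) 0 : ℕ∞) : ENNReal)
        ≤ T * ((order (fun ζ => (φ ζ).1 - x.1) 0 : ℕ∞) : ENNReal))
    (hB : ∀ i, x.2 i ≠ 0 → 2 ≤ T) : typ (hartogsFun ρ h) x ≤ T := by
  refine iSup₂_le fun φ hφ => ?_
  -- Division by `⊤` gives 0 in `ENNReal`, so no identity theorem is needed to exclude infinite
  -- order.
  by_cases hne : order (fun ζ => φ ζ - x) 0 = ⊤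
  · simp [hne]
  refine ENNReal.div_le_of_le_mul ?_
  obtain ⟨hR, hRA⟩ := hφ.order_hartogsFun_le hρ hp hh hx
  rcases exists_order_component_le hφ.contDiffAt hne with h1 | ⟨i, hi⟩
  · calc _ ≤ ((order (nonvanishingPart ρ h x φ) 0 : ℕ∞) : ENNReal) := ENat.toENNReal_le.2 hR
      _ ≤ _ := hfst φ hφ (ne_top_of_le_ne_top hne h1)
      _ ≤ _ := mul_le_mul_right (ENat.toENNReal_le.2 h1) T
  · by_cases hxi : x.2 i = 0
    · have hd : DifferentiableOn ℂ (fun ζ => (φ ζ).2 i) (Metric.ball 0 1) :=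
        (coord E F i).differentiable.comp_differentiableOn hφ.holomorphic
      calc _ ≤ ((order (fun ζ => h i ((φ ζ).2 i) - h i (x.2 i)) 0 : ℕ∞) : ENNReal) :=
            ENat.toENNReal_le.2 (hRA i hxi)
        _ ≤ typ (h i) (x.2 i) * ((order (fun ζ => (φ ζ).2 i - x.2 i) 0 : ℕ∞) : ENNReal) :=
            order_le_typ_mul_order hd (by rw [hφ.center]) (ne_top_of_le_ne_top hne hi)
        _ ≤ _ := mul_le_mul' (by rw [hxi]; exact hA i hxi) (ENat.toENNReal_le.2 hi)
    · calc _ ≤ ((2 * order (fun ζ => (φ ζ).2 i - x.2 i) 0 : ℕ∞) : ENNReal) :=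
            ENat.toENNReal_le.2 (hR.trans (hφ.order_nonvanishingPart_le_snd hρ hp hh hx hxi))
        _ = 2 * ((order (fun ζ => (φ ζ).2 i - x.2 i) 0 : ℕ∞) : ENNReal) := by
            rw [ENat.toENNReal_mul]; rfl
        _ ≤ _ := mul_le_mul' (hB i hxi) (ENat.toENNReal_le.2 hi)

theorem IsDiscAt.order_fst_part_le (hφ : IsDiscAt φ x)
    (hne : order (fun ζ => (φ ζ).1 - x.1) 0 ≠ ⊤) :
    ((order (fun ζ => ρ (φ ζ).1 - ρ x.1) 0 : ℕ∞) : ENNReal)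
      ≤ typ ρ x.1 * ((order (fun ζ => (φ ζ).1 - x.1) 0 : ℕ∞) : ENNReal) :=
  order_le_typ_mul_order (φ := fun ζ => (φ ζ).1)
    (differentiable_fst.comp_differentiableOn hφ.holomorphic) (by rw [hφ.center]) hne

theorem bdryTyp_hartogsDomain_le_of_snd_eq_zero (hΩ : IsOpen Ω)
    (hρ : IsDefiningFunctionOn Ω ρ U) (hp : IsPshOn ρ U) (hh : ConditionII h)
    (hx : x ∈ frontier (hartogsDomain Ω ρ h)) (hx2 : x.2 = 0) :
    bdryTyp (hartogsDomain Ω ρ h) x ≤ max (bdryTyp Ω x.1) (⨆ i, typ (h i) 0) := by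
  refine (isLocalDefiningFunction_hartogsFun hΩ hρ hh hx).bdryTyp_le.trans ?_
  have hz := fst_mem_frontier hΩ hρ hh hx hx2
  refine typ_hartogsFun_le hρ hp hh (hρ.closure_subset hz.1)
    (fun i _ => le_max_of_le_right (le_iSup (fun i => typ (h i) 0) i)) (fun φ hφ hne => ?_)
    fun i hi => absurd (congrFun hx2 i) hi
  have e : nonvanishingPart ρ h x φ = fun ζ => ρ (φ ζ).1 - ρ x.1 := by
    ext ζ
    simp [nonvanishingPart, hx2]
  rw [e]
  exact (hφ.order_fst_part_le hne).trans (mul_le_mul_left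
    (le_max_of_le_left (hρ.isLocalDefiningFunction hΩ hz).typ_le_bdryTyp) _)

/-- The bound is valid at every boundary point, including `w = 0`, and so yields finite type by
itself. -/
theorem bdryTyp_hartogsDomain_le_of_snd_ne_zero [Nontrivial E] (hΩ : IsOpen Ω)
    (hρ : IsDefiningFunctionOn Ω ρ U) (hp : IsPshOn ρ U) (hh : ConditionII h)
    (hx : x ∈ frontier (hartogsDomain Ω ρ h)) :
    bdryTyp (hartogsDomain Ω ρ h) x
      ≤ max (2 * typ ρ x.1) (⨆ (i : ι) (_ : x.2 i = 0), typ (h i) 0) := by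
  refine (isLocalDefiningFunction_hartogsFun hΩ hρ hh hx).bdryTyp_le.trans ?_
  have hxU := hρ.closure_subset (fst_mem_closure_of_mem_frontier hx)
  refine typ_hartogsFun_le hρ hp hh hxU
    (fun i hi => le_max_of_le_right (le_iSup₂_of_le i hi le_rfl)) (fun φ hφ hne => ?_)
    fun i _ => le_max_of_le_left ?_
  · calc _ ≤ ((2 * order (fun ζ => ρ (φ ζ).1 - ρ x.1) 0 : ℕ∞) : ENNReal) :=
          ENat.toENNReal_le.2 (hφ.order_nonvanishingPart_le_fst hρ hp hh hxU)
      _ = 2 * ((order (fun ζ => ρ (φ ζ).1 - ρ x.1) 0 : ℕ∞) : ENNReal) := by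
          rw [ENat.toENNReal_mul]; rfl
      _ ≤ 2 * (typ ρ x.1 * ((order (fun ζ => (φ ζ).1 - x.1) 0 : ℕ∞) : ENNReal)) :=
          mul_le_mul_right (hφ.order_fst_part_le hne) 2
      _ = 2 * typ ρ x.1 * ((order (fun ζ => (φ ζ).1 - x.1) 0 : ℕ∞) : ENNReal) :=
          (mul_assoc _ _ _).symm
      _ ≤ _ := mul_le_mul_left (le_max_left _ _) _
  · calc (2 : ENNReal) = 2 * 1 := (mul_one 2).symm
      _ ≤ 2 * typ ρ x.1 := mul_le_mul_right (one_le_typ ρ x.1) 2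

theorem isOfFiniteType_hartogsDomain [Nontrivial E] (hΩ : IsOpen Ω)
    (hρ : IsDefiningFunctionOn Ω ρ U) (hp : IsPshOn ρ U)
    (hfin : ∀ z ∈ closure Ω, typ ρ z < ⊤) (hh : ConditionII h) :
    IsOfFiniteType (hartogsDomain Ω ρ h) := by
  intro x hx
  refine (bdryTyp_hartogsDomain_le_of_snd_ne_zero hΩ hρ hp hh hx).trans_lt (max_lt ?_ ?_)
  · exact ENNReal.mul_lt_top (by simp) (hfin _ (fst_mem_closure_of_mem_frontier hx))
  -- The finite sum of the types dominates the supremum and covers an empty index set.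
  · refine lt_of_le_of_lt (iSup_le fun i => iSup_le fun _ => ?_)
      (ENNReal.sum_lt_top (s := Finset.univ).2 fun i _ => (hh i).finite_type)
    exact Finset.single_le_sum (f := fun i => typ (h i) 0) (fun _ _ => zero_le)
      (Finset.mem_univ i)

end Estimate

end Hartogs

theorem mainTheorem9 (n : ℕ) (hn : 0 < n) (p : ℕ) (m : Fin p → ℕ)
    (Ω U : Set (EuclideanSpace ℂ (Fin n))) (ρ : EuclideanSpace ℂ (Fin n) → ℝ)
    (h : ∀ i : Fin p, EuclideanSpace ℂ (Fin (m i)) → ℝ)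
    (hΩ : Hartogs.IsSmoothBoundedDomain Ω)
    (hρ : Hartogs.IsDefiningFunctionOn Ω ρ U)
    (hρ_psh : Hartogs.IsPshOn ρ U)
    (hρ_type : ∀ z ∈ closure Ω, Hartogs.typ ρ z < ⊤)
    (hh : Hartogs.ConditionII h) :
    Hartogs.IsSmoothBoundedDomain (Hartogs.hartogsDomain Ω ρ h) ∧
    Hartogs.IsPseudoconvex (Hartogs.hartogsDomain Ω ρ h) ∧
    Hartogs.IsOfFiniteType (Hartogs.hartogsDomain Ω ρ h) ∧
    ∀ x ∈ frontier (Hartogs.hartogsDomain Ω ρ h),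
      (x.2 = 0 →
        Hartogs.bdryTyp (Hartogs.hartogsDomain Ω ρ h) x
          ≤ max (Hartogs.bdryTyp Ω x.1) (⨆ i, Hartogs.typ (h i) 0)) ∧
      (x.2 ≠ 0 →
        Hartogs.bdryTyp (Hartogs.hartogsDomain Ω ρ h) x
          ≤ max (2 * Hartogs.typ ρ x.1)
              (⨆ (i : Fin p) (_ : x.2 i = 0), Hartogs.typ (h i) 0)) := by
  have : Nonempty (Fin n) := ⟨⟨0, hn⟩⟩
  exact ⟨Hartogs.isSmoothBoundedDomain_hartogsDomain hΩ hρ hh,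
    Hartogs.isPseudoconvex_hartogsDomain hΩ.isOpen hρ hρ_psh hh,
    Hartogs.isOfFiniteType_hartogsDomain hΩ.isOpen hρ hρ_psh hρ_type hh,
    fun x hx => ⟨Hartogs.bdryTyp_hartogsDomain_le_of_snd_eq_zero hΩ.isOpen hρ hρ_psh hh hx,
      fun _ => Hartogs.bdryTyp_hartogsDomain_le_of_snd_ne_zero hΩ.isOpen hρ hρ_psh hh hx⟩⟩
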